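/- Let $k$ be a field, let $X$ be a projective scheme over $k$ and let $S$ be a scheme over $k$; write $X\times S$ for the product over $k$. Unions and intersections of closed subschemes are scheme-theoretic: they are defined by the intersection and the sum of the ideals, respectively. Let $\mathcal Y\subset X\times S$ be a closed subscheme that is flat over $S$, let $E\subset S$ be an (effective) Cartier divisor, and let $\mathcal V\subset X\times E$ be a closed subscheme that is flat over $E$ and satisfies $\mathcal Y\cap(X\times E)\subset\mathcal V$. Regard $\mathcal V$ as a closed subscheme of $X\times S$ and let $\mathcal I_{\mathcal Y\cup\mathcal V}\subset\mathcal O_{X\times S}$ be the ideal sheaf of $\mathcal Y\cup\mathcal V$. For a point $\xi\in S$ let $X_\xi$ be the fibre of $X\times S\to S$ over $\xi$, let $\mathcal Y_\xi,\mathcal V_\xi\subset X_\xi$ be the fibres of $\mathcal Y$ and $\mathcal V$, and let $\mathcal I_{\mathcal Y\cup\mathcal V}\otimes k(\xi)$ be the pullback of $\mathcal I_{\mathcal Y\cup\mathcal V}$, as a sheaf of modules, to $X_\xi$. Then for every $\xi\in E$ one has $\mathcal Y_\xi\subset\mathcal V_\xi$, and there is a short exact sequence of $\mathcal O_{X_\xi}$-modules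 $$0\to\mathcal I_{\mathcal Y_\xi/\mathcal V_\xi}\to\mathcal I_{\mathcal Y\cup\mathcal V}\otimes k(\xi)\to\mathcal I_{\mathcal V_\xi}\to 0,$$ where $\mathcal I_{\mathcal V_\xi}\subset\mathcal O_{X_\xi}$ is the ideal sheaf of $\mathcal V_\xi$ and $\mathcal I_{\mathcal Y_\xi/\mathcal V_\xi}\subset\mathcal O_{\mathcal V_\xi}$ is the ideal sheaf defining $\mathcal Y_\xi$ as a subscheme of $\mathcal V_\xi$, regarded as an $\mathcal O_{X_\xi}$-module. Moreover, if $S$ is integral in a neighbourhood of $E$ (it is enough that every point of $E$ has an open neighbourhood in $S$ that is an integral scheme), then $\mathcal I_{\mathcal Y\cup\mathcal V}$ is flat over $S$. -/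

import Mathlib

universe u

open CategoryTheory CategoryTheory.Limits AlgebraicGeometry

noncomputable section

namespace OppositeSES

attribute [local instance] MvPolynomial.gradedAlgebra

/-- Projective `n`-space over a field `k`, as `Proj k[x₀, …, xₙ]`. -/
def projSpace (k : Type u) [Field k] (n : ℕ) : Scheme.{u} :=
  Proj (MvPolynomial.homogeneousSubmodule (Fin (n + 1)) k)

/-- The structure morphism `ℙⁿ ⟶ Spec k`. -/
def projSpaceToSpec (k : Type u) [Field k] (n : ℕ) : projSpace k n ⟶ Spec (.of k) :=
  Proj.toSpecZero (MvPolynomial.homogeneousSubmodule (Fin (n + 1)) k) ≫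
    Spec.map (CommRingCat.ofHom
      (algebraMap k (MvPolynomial.homogeneousSubmodule (Fin (n + 1)) k 0)))

/-- A `k`-scheme `X` is projective if it is isomorphic, over `k`, to a closed subscheme of some
projective space `ℙⁿ` over `k`. -/
def IsProjective {k : Type u} [Field k] {X : Scheme.{u}} (f : X ⟶ Spec (.of k)) : Prop :=
  ∃ (n : ℕ) (i : X ⟶ projSpace k n), IsClosedImmersion i ∧ i ≫ projSpaceToSpec k n = f

/-- The closed subscheme with ideal sheaf `E` is a Cartier divisor: around every point, `E` is
generated by one section that is not a zero divisor. -/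
def IsCartierDivisor {S : Scheme.{u}} (E : S.IdealSheafData) : Prop :=
  ∀ s : S, ∃ U : S.affineOpens, s ∈ U.1 ∧
    ∃ f ∈ nonZeroDivisors Γ(S, U.1), E.ideal U = Ideal.span {f}

/-- The structure sheaf of `X`, as a module over itself. -/
def structureModule (X : Scheme.{u}) : X.Modules :=
  SheafOfModules.unit.{u} X.ringCatSheaf

/-- The canonical morphism of `𝒪_X`-modules `𝒪_X ⟶ i_* 𝒪_Z` of a morphism `i : Z ⟶ X`. -/
def toPushforwardStructure {Z X : Scheme.{u}} (i : Z ⟶ X) :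
    structureModule X ⟶ (Scheme.Modules.pushforward i).obj (structureModule Z) :=
  SheafOfModules.unitToPushforwardObjUnit i.toRingCatSheafHom

/-- The ideal sheaf of a closed immersion `i : Z ⟶ X`, as an `𝒪_X`-module: the kernel of
`𝒪_X ⟶ i_* 𝒪_Z`. -/
def idealSheaf {Z X : Scheme.{u}} (i : Z ⟶ X) : X.Modules :=
  kernel (toPushforwardStructure i)

/-- For closed subschemes `Z ⊆ W` of `X` with ideals `W ≤ Z`, the relative ideal sheaf of `Z` in
`W`, that is, the ideal sheaf in `𝒪_W` that defines `Z` as a subscheme of `W`, regarded as an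
`𝒪_X`-module by pushforward along the inclusion of `W` in `X`. -/
def relativeIdealSheaf {X : Scheme.{u}} {W Z : X.IdealSheafData} (h : W ≤ Z) : X.Modules :=
  (Scheme.Modules.pushforward W.subschemeι).obj
    (idealSheaf (Scheme.IdealSheafData.inclusion h))

/-- The stalk `M_x` of an `𝒪_X`-module. -/
abbrev stalkAt {X : Scheme.{u}} (M : X.Modules) (x : X) : Type u :=
  ↑(TopCat.Presheaf.stalk (C := Ab) M.presheaf x)

/-- The stalk of an `𝒪_X`-module at `x` is a module over the local ring `𝒪_{X,x}`. -/
instance stalkModule {X : Scheme.{u}} (M : X.Modules) (x : X) :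
    Module (X.presheaf.stalk x) (stalkAt M x) :=
  PresheafOfModules.instModuleCarrierStalkCommRingCatCarrierAbPresheafOpensCarrier
    (R := X.presheaf) M.val x

/-- An `𝒪_X`-module `M` is flat over `S` along `p : X ⟶ S`: every stalk `M_x` is a flat module
over `𝒪_{S,p(x)}`. -/
def IsFlatOver {X S : Scheme.{u}} (p : X ⟶ S) (M : X.Modules) : Prop :=
  ∀ x : X,
    letI : Module (S.presheaf.stalk (p x)) (stalkAt M x) :=
      Module.compHom _ (p.stalkMap x).hom
    Module.Flat (S.presheaf.stalk (p x)) (stalkAt M x)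

end OppositeSES

end

/-! Everything is local at a point. Let `A → R` be the map of local rings of `S` and `X × S`, `t` an
equation of `E`, `I` and `J` the ideals of `Y` and `V`, `κ` the residue field of `A`. Then `R` and
`R/I` are flat over `A`, `R/J` is flat over `A/t`, `t ∈ J`, and `J ⊆ I + tR`.

Flatness. As `t` is a nonzerodivisor on `R/I`, `J/(I ∩ J) = (I + tR)/I ≅ R/I` is flat over `A`.
Hence `(I ∩ J) ⊗ κ → J ⊗ κ` is injective, and `I ∩ J` is flat once `J` is. The ideal `J` is flat
since `R/J`, being flat over `A/t`, has Tor-dimension at most one over `A`.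

The sequence. Over a point of `E`, `Tor₁(R/J, κ) ≅ R/(J + 𝔪R)` with `t` as generator, which gives `0
→ 𝒪_{V_ξ} → I_V ⊗ k(ξ) → I_{V_ξ} → 0`, the first map being multiplication by `t`. The subsheaf `I_{Y
∪ V} ⊗ k(ξ)` of the middle term still maps onto `I_{V_ξ}`, because each `j ∈ J` is congruent modulo
`t` to an element of `I ∩ J`, and it meets `𝒪_{V_ξ}` in the relative ideal of `Y_ξ`.

Tor is replaced by the equational criterion for flatness, stated with elements of `R`
(`FlatModulo`). The algebra is in `FlatModulo.inf_flat_of_flat` and `IsFlatPair.isFiberPair`. It is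
carried to sheaves by `stalkIdealEquiv`, `Hom.ker_stalkMap_fiberι` and `pullbackStalk_eq_zero_iff`,
and `exists_shortExact_pullback` builds the global maps; this is possible because one equation `t`
serves on a neighbourhood of the whole fibre. -/

section FlatModulo

/-! ### Commutative algebra: flatness through linear relations. -/

variable {A R : Type*} [CommRing A] [CommRing R] [Algebra A R]

/-- Finite systems of `A`-linear relations that hold in `R ⧸ J` are consequences of relations
between coefficients that hold modulo `t`. If `R ⧸ J` is a module over `A ⧸ t`, this is its
flatness. -/
def FlatModulo (t : A) (J : Ideal R) : Prop :=
  ∀ ⦃n l : ℕ⦄ (f : Fin l → Fin n → A) (x : Fin n → R), (∀ k, ∑ i, f k i • x i ∈ J) →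
    ∃ (p : ℕ) (a : Fin n → Fin p → A) (y : Fin p → R),
      (∀ i, x i - ∑ j, a i j • y j ∈ J) ∧ ∀ k j, ∃ g, ∑ i, f k i * a i j = t * g

/-- The equational criterion for several relations at once: `f` is a map `Bˡ → Bⁿ` killed by `x : Bⁿ
→ N`, so `x` factors through a finite free module in which `f` already dies. -/
lemma Module.Flat.exists_of_forall_sum_smul_eq_zero {B N : Type*} [CommRing B] [AddCommGroup N]
    [Module B N] [Module.Flat B N] {n l : ℕ} (f : Fin l → Fin n → B) (x : Fin n → N)
    (h : ∀ k, ∑ i, f k i • x i = 0) :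
    ∃ (p : ℕ) (a : Fin n → Fin p → B) (y : Fin p → N),
      (∀ i, x i = ∑ j, a i j • y j) ∧ ∀ k j, ∑ i, f k i * a i j = 0 := by
  obtain ⟨p, a, y, hy, ha⟩ := Module.Flat.exists_factorization_of_comp_eq_zero_of_free
    (R := B) (M := N) (f := Fintype.linearCombination B f)
    (x := Fintype.linearCombination B x) (by
      ext k
      simp [Fintype.linearCombination_apply, h])
  refine ⟨p, fun i j ↦ a (Pi.single i 1) j, fun j ↦ y (Finsupp.single j 1), fun i ↦ ?_,
    fun k j ↦ ?_⟩
  · have := LinearMap.congr_fun hy (Pi.single i 1)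
    simp only [Fintype.linearCombination_apply_single, one_smul, LinearMap.comp_apply] at this
    rw [this]
    conv_lhs => rw [← Finsupp.univ_sum_single (a (Pi.single i 1)), map_sum]
    simp_rw [← map_smul, Finsupp.smul_single_one]
  · have := congr($(LinearMap.congr_fun ha (Pi.single k 1)) j)
    simp only [LinearMap.comp_apply, Fintype.linearCombination_apply_single, one_smul] at this
    rw [← Finset.univ_sum_single (f k), map_sum, Finsupp.finsetSum_apply] at this
    refine .trans (Finset.sum_congr rfl fun i _ ↦ ?_) this
    rw [← smul_eq_mul, ← Finsupp.smul_apply, ← map_smul, ← Pi.single_smul, smul_eq_mul, mul_one]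

/-- `B` and `N` play `A ⧸ t` and `R ⧸ J`, but only up to surjections with prescribed kernels, the
form in which the local rings of closed subschemes occur. -/
lemma FlatModulo.of_flat {B N : Type*} [CommRing B] [CommRing N] (ρ : A →+* B) (σ : B →+* N)
    (π : R →+* N) (comm : ∀ a, σ (ρ a) = π (algebraMap A R a)) (t : A) (J : Ideal R)
    (hρ : Function.Surjective ρ) (hρ' : ∀ a, ρ a = 0 → ∃ c, a = t * c)
    (hπ : Function.Surjective π) (hπ' : RingHom.ker π = J) (hσ : σ.Flat) : FlatModulo t J := by
  subst hπ'
  intro n l f x hx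
  algebraize [σ]
  obtain ⟨p, a, y, h1, h2⟩ := Module.Flat.exists_of_forall_sum_smul_eq_zero
    (B := B) (N := N) (fun k i ↦ ρ (f k i)) (fun i ↦ π (x i)) (fun k ↦ by
      have := hx k
      rw [RingHom.mem_ker] at this
      simpa [Algebra.smul_def, RingHom.algebraMap_toAlgebra, comm] using this)
  choose a' ha' using fun i j ↦ hρ (a i j)
  choose y' hy' using fun j ↦ hπ (y j)
  refine ⟨p, a', y', fun i ↦ ?_, fun k j ↦ hρ' _ ?_⟩
  · rw [RingHom.mem_ker]
    simp [h1, Algebra.smul_def, ← comm, RingHom.algebraMap_toAlgebra, ha', hy']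
  · simp [ha', h2]

lemma FlatModulo.top (t : A) : FlatModulo t (⊤ : Ideal R) := fun _ _ _ _ _ ↦
  ⟨0, fun _ ↦ Fin.elim0, Fin.elim0, by simp, fun _ j ↦ j.elim0⟩

/-- A nonzerodivisor of `A` stays a nonzerodivisor on the flat module `R ⧸ I`. -/
lemma FlatModulo.mul_mem {I : Ideal R} (hI : FlatModulo (0 : A) I) {t : A}
    (ht : t ∈ nonZeroDivisors A) {r : R} (h : t • r ∈ I) : r ∈ I := by
  obtain ⟨p, a, y, h1, h2⟩ := hI (n := 1) (l := 1) (fun _ _ ↦ t) (fun _ ↦ r) (by simpa using h)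
  have h3 (j) : a 0 j = 0 := by
    obtain ⟨g, hg⟩ := h2 0 j
    exact (mul_left_mem_nonZeroDivisors_eq_zero_iff ht).mp (by simpa using hg)
  simpa [h3] using h1 0

lemma Ideal.exists_of_mem_map_mul {𝔪 : Ideal A} {K : Ideal R} {x : R}
    (hx : x ∈ 𝔪.map (algebraMap A R) * K) :
    ∃ (n : ℕ) (m : Fin n → A) (r : Fin n → R), (∀ i, m i ∈ 𝔪) ∧ (∀ i, r i ∈ K) ∧
      x = ∑ i, m i • r i := by
  have hx : x ∈ 𝔪 • K.restrictScalars A := by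
    rw [← Ideal.smul_restrictScalars]
    exact hx
  clear * - hx
  induction hx using Submodule.smul_induction_on' with
  | smul a ha r hr => exact ⟨1, fun _ ↦ a, fun _ ↦ r, fun _ ↦ ha, fun _ ↦ hr, by simp⟩
  | add x hx' y hy' hx hy =>
    obtain ⟨n, m, r, h1, h2, rfl⟩ := hx
    obtain ⟨n', m', r', h1', h2', rfl⟩ := hy
    refine ⟨n + n', Fin.append m m', Fin.append r r', fun i ↦ ?_, fun i ↦ ?_, ?_⟩
    · induction i using Fin.addCases <;> simp [*]
    · induction i using Fin.addCases <;> simp [*]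
    · simp [Fin.sum_univ_add]

lemma Ideal.sum_smul_mem_map_mul {𝔪 : Ideal A} {K : Ideal R} {n : ℕ} {m : Fin n → A}
    {r : Fin n → R} (hm : ∀ i, m i ∈ 𝔪) (hr : ∀ i, r i ∈ K) :
    ∑ i, m i • r i ∈ 𝔪.map (algebraMap A R) * K := by
  refine _root_.sum_mem fun i _ ↦ ?_
  · rw [Algebra.smul_def]
    exact Ideal.mul_mem_mul (Ideal.mem_map_of_mem _ (hm i)) (hr i)

variable {t : A} {I J : Ideal R} {𝔪 : Ideal A}

/-- A kernel of a map from a flat `A`-module onto a flat `A ⧸ t`-module is flat over `A`. -/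
lemma FlatModulo.flat_of_flat [Module.Flat A R] (ht : t ∈ nonZeroDivisors A)
    (htJ : algebraMap A R t ∈ J) (hJ : FlatModulo t J) : Module.Flat A J := by
  refine Module.Flat.of_forall_isTrivialRelation fun {l f x} h ↦ ?_
  have h : ∑ i, f i • (x i : R) = 0 := by simpa using congr(($h : R))
  obtain ⟨m, b, z, hz, hb⟩ := Module.Flat.exists_of_forall_sum_smul_eq_zero
    (B := A) (N := R) (l := 1) (fun _ ↦ f) (fun i ↦ (x i : R)) (fun _ ↦ h)
  obtain ⟨p, e, w, hw, he⟩ := hJ b z (fun i ↦ hz i ▸ (x i).2)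
  choose g hg using he
  -- Since `z = (z - e w) + e w` and `b e = t g`, one has `x = b (z - e w) + g (t w)`, with both
  -- families of generators in `J`. Cancelling `t` in `t (f g) = f b e = 0` shows that `g`
  -- trivialises the relation too.
  refine ⟨m + p, fun i ↦ Fin.append (b i) (g i),
    Fin.append (fun j ↦ ⟨_, hw j⟩) (fun j ↦ ⟨t • w j, ?_⟩), fun i ↦ ?_, ?_⟩
  · rw [Algebra.smul_def]
    exact J.mul_mem_right _ htJ
  · ext
    simp only [Fin.sum_univ_add, Fin.append_left, Fin.append_right, Submodule.coe_add,
      Submodule.coe_sum, Submodule.coe_smul_of_tower]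
    simp_rw [smul_sub, smul_smul, mul_comm (g _ _) t, ← hg, Finset.sum_sub_distrib,
      Finset.smul_sum, Finset.sum_smul, smul_smul]
    rw [Finset.sum_comm (s := Finset.univ (α := Fin p)), sub_add_cancel, hz]
  · intro j
    induction j using Fin.addCases with
    | left j => simpa using hb 0 j
    | right j =>
      rw [← mul_left_mem_nonZeroDivisors_eq_zero_iff ht]
      simp only [Fin.append_right]
      simp_rw [Finset.mul_sum, mul_left_comm t, ← hg, Finset.mul_sum]
      rw [Finset.sum_comm]
      simp_rw [← mul_assoc, ← Finset.sum_mul]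
      refine Finset.sum_eq_zero fun k _ ↦ ?_
      rw [show ∑ i, f i * b i k = 0 from hb 0 k, zero_mul]

/-- `I ⊓ J` is the kernel of a surjection from the flat module `J` onto the flat module `R ⧸ I`,
sending `i + t r` to the class of `r`. A relation is trivialised in `J` and its generators are then
corrected to lie in `I`. -/
lemma FlatModulo.inf_flat_of_flat [Module.Flat A R] (ht : t ∈ nonZeroDivisors A)
    (htJ : algebraMap A R t ∈ J) (hI : FlatModulo (0 : A) I)
    (hJI : ∀ j ∈ J, ∃ i ∈ I, ∃ r, j = i + t • r) (hJ : FlatModulo t J) :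
    Module.Flat A (I ⊓ J : Ideal R) := by
  have := FlatModulo.flat_of_flat ht htJ hJ
  refine Module.Flat.of_forall_isTrivialRelation fun {l f x} h ↦ ?_
  obtain ⟨m, b, y, hy, hb⟩ := Module.Flat.exists_of_forall_sum_smul_eq_zero
    (B := A) (N := J) (l := 1) (fun _ ↦ f) (fun i ↦ ⟨x i, (x i).2.2⟩) (fun _ ↦ by
      ext; simpa using congr(($h : R)))
  have hy (i) : (x i : R) = ∑ k, b i k • (y k : R) := by simpa using congr(($(hy i) : R))
  choose i' hi' r hr using fun k ↦ hJI (y k) (y k).2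
  have key (i) : ∑ k, b i k • r k ∈ I := by
    refine hI.mul_mem ht ?_
    have : t • ∑ k, b i k • r k = x i - ∑ k, b i k • i' k := by
      rw [hy, ← Finset.sum_sub_distrib, Finset.smul_sum]
      refine Finset.sum_congr rfl fun k _ ↦ ?_
      rw [hr k, smul_add, add_sub_cancel_left, smul_comm]
    rw [this]
    exact sub_mem (x i).2.1 (sum_mem fun k _ ↦ Submodule.smul_of_tower_mem _ _ (hi' k))
  obtain ⟨p, e, w, hw, he⟩ := hI b r key
  have he (k j) : ∑ i, b k i * e i j = 0 := by obtain ⟨g, hg⟩ := he k j; simpa using hg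
  -- Subtracting `t (e w)` from `y = i' + t r` keeps it in `J`, moves it into `I` because `r - e w ∈
  -- I`, and leaves `b y` unchanged because `b e = 0`.
  refine ⟨m, b, fun k ↦ ⟨i' k + t • (r k - ∑ j, e k j • w j), ?_, ?_⟩,
    fun i ↦ ?_, fun j ↦ by simpa using hb 0 j⟩
  · exact add_mem (hi' k) (Submodule.smul_of_tower_mem _ _ (hw k))
  · rw [smul_sub, ← add_sub_assoc, ← hr]
    refine sub_mem (y k).2 ?_
    rw [Algebra.smul_def]
    exact J.mul_mem_right _ htJ
  · ext
    have : ∑ k, b i k • (∑ j, e k j • w j) = 0 := by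
      simp_rw [Finset.smul_sum, smul_smul]
      rw [Finset.sum_comm]
      simp_rw [← Finset.sum_smul, he, zero_smul, Finset.sum_const_zero]
    simp only [Submodule.coe_sum, Submodule.coe_smul_of_tower]
    simp_rw [smul_sub t, ← add_sub_assoc, ← hr, smul_sub, Finset.sum_sub_distrib]
    simp_rw [smul_comm (b i _) t]
    rw [← Finset.smul_sum, this, smul_zero, sub_zero, hy]

/-- Injectivity of `(I ⊓ J) ⊗ A/𝔪 → J ⊗ A/𝔪`, a consequence of the flatness of `J/(I ⊓ J) ≅ R/I`.
The generators are corrected as in `FlatModulo.inf_flat_of_flat`, with the coefficients `m` in the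
place of `b`. -/
lemma FlatModulo.mem_mul_inf_of_mem (ht : t ∈ nonZeroDivisors A)
    (htJ : algebraMap A R t ∈ J) (hI : FlatModulo (0 : A) I)
    (hJI : ∀ j ∈ J, ∃ i ∈ I, ∃ r, j = i + t • r) {z : R} (hzI : z ∈ I)
    (hz : z ∈ 𝔪.map (algebraMap A R) * J) : z ∈ 𝔪.map (algebraMap A R) * (I ⊓ J) := by
  obtain ⟨n, m, y, hm, hy, rfl⟩ := Ideal.exists_of_mem_map_mul hz
  choose i' hi' r hr using fun k ↦ hJI (y k) (hy k)
  have key : ∑ k, m k • r k ∈ I := by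
    refine hI.mul_mem ht ?_
    have : t • ∑ k, m k • r k = ∑ k, m k • y k - ∑ k, m k • i' k := by
      rw [← Finset.sum_sub_distrib, Finset.smul_sum]
      refine Finset.sum_congr rfl fun k _ ↦ ?_
      rw [hr k, smul_add, add_sub_cancel_left, smul_comm]
    rw [this]
    exact sub_mem hzI (sum_mem fun k _ ↦ Submodule.smul_of_tower_mem _ _ (hi' k))
  obtain ⟨p, e, w, hw, he⟩ := hI (l := 1) (fun _ ↦ m) r (fun _ ↦ key)
  have he (j) : ∑ i, m i * e i j = 0 := by obtain ⟨g, hg⟩ := he 0 j; simpa using hg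
  have : ∑ k, m k • y k = ∑ k, m k • (i' k + t • (r k - ∑ j, e k j • w j)) := by
    have : ∑ k, m k • (∑ j, e k j • w j) = 0 := by
      simp_rw [Finset.smul_sum, smul_smul]
      rw [Finset.sum_comm]
      simp_rw [← Finset.sum_smul, he, zero_smul, Finset.sum_const_zero]
    simp_rw [smul_sub t, ← add_sub_assoc, ← hr, smul_sub, Finset.sum_sub_distrib]
    simp_rw [smul_comm (m _) t]
    rw [← Finset.smul_sum, this, smul_zero, sub_zero]
  rw [this]
  refine Ideal.sum_smul_mem_map_mul hm fun k ↦ ⟨add_mem (hi' k)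
    (Submodule.smul_of_tower_mem _ _ (hw k)), ?_⟩
  rw [smul_sub, ← add_sub_assoc, ← hr]
  refine sub_mem (hy k) ?_
  rw [Algebra.smul_def]
  exact J.mul_mem_right _ htJ

/-- The kernel of `J/𝔪J → R/𝔪R` is `Tor₁(R/J, A/𝔪)`; it consists of multiples of the class of `t`.
-/
lemma FlatModulo.exists_of_mem_map (hJ : FlatModulo t J) {z : R} (hzJ : z ∈ J)
    (hz : z ∈ 𝔪.map (algebraMap A R)) :
    ∃ r, z - t • r ∈ 𝔪.map (algebraMap A R) * J := by
  rw [← Ideal.mul_top (𝔪.map _)] at hz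
  obtain ⟨n, m, y, hm, hy, rfl⟩ := Ideal.exists_of_mem_map_mul hz
  obtain ⟨p, e, w, hw, he⟩ := hJ (l := 1) (fun _ ↦ m) y (fun _ ↦ hzJ)
  choose g hg using he 0
  refine ⟨∑ j, g j • w j, ?_⟩
  have : ∑ i, m i • y i - t • ∑ j, g j • w j = ∑ i, m i • (y i - ∑ j, e i j • w j) := by
    simp_rw [smul_sub, Finset.sum_sub_distrib, Finset.smul_sum, smul_smul]
    rw [Finset.sum_comm (s := Finset.univ (α := Fin n)) (t := Finset.univ (α := Fin p))]
    simp_rw [← Finset.sum_smul, hg]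
  rw [this]
  exact Ideal.sum_smul_mem_map_mul hm hw

/-- The complement to `FlatModulo.exists_of_mem_map`: for `t ∈ 𝔪` the annihilator of the class of
`t` in `J/𝔪J` is no larger than `J + 𝔪R`. -/
lemma FlatModulo.exists_of_smul_mem [Module.Flat A R] (ht : t ∈ nonZeroDivisors A)
    (hJ : FlatModulo t J) {r : R} (hr : t • r ∈ 𝔪.map (algebraMap A R) * J) :
    r ∈ J ⊔ 𝔪.map (algebraMap A R) := by
  obtain ⟨n, m, y, hm, hy, hr⟩ := Ideal.exists_of_mem_map_mul hr
  -- The equation `t r = ∑ mᵢ yᵢ` is a relation in the flat module `R` between `r` (index `0`) and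
  -- the `yᵢ` (index `i + 1`).
  obtain ⟨q, c, z, hz, hc⟩ := Module.Flat.exists_of_forall_sum_smul_eq_zero
    (B := A) (N := R) (l := 1) (n := n + 1) (fun _ ↦ Fin.cons t (fun i ↦ - m i)) (Fin.cons r y)
    (fun _ ↦ by simp [Fin.sum_univ_succ, hr])
  have hc (k) : t * c 0 k = ∑ i, m i * c (Fin.succ i) k := by
    simpa [Fin.sum_univ_succ, add_neg_eq_zero] using hc 0 k
  have hy' (i) : y i = ∑ k, c (Fin.succ i) k • z k := by simpa using hz (Fin.succ i)
  have hr' : r = ∑ k, c 0 k • z k := by simpa using hz 0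
  obtain ⟨p, e, w, hw, he⟩ := hJ (fun i ↦ c (Fin.succ i)) z (fun i ↦ hy' i ▸ hy i)
  choose g hg using he
  -- Cancelling `t` puts the coefficients of `r` along the `w j` in `𝔪`; the remainder of `r` is in
  -- `J`.
  have h1 (j) : ∑ k, c 0 k * e k j = ∑ i, m i * g i j := by
    rw [← sub_eq_zero, ← mul_left_mem_nonZeroDivisors_eq_zero_iff ht, mul_sub, sub_eq_zero]
    simp_rw [Finset.mul_sum, ← mul_assoc, hc, mul_comm t, mul_assoc, ← hg, Finset.sum_mul,
      Finset.mul_sum, mul_assoc]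
    exact Finset.sum_comm
  have h2 : r = ∑ k, c 0 k • (z k - ∑ j, e k j • w j) + ∑ j, (∑ i, m i * g i j) • w j := by
    simp_rw [← h1, smul_sub, Finset.sum_sub_distrib, Finset.smul_sum, smul_smul, Finset.sum_smul]
    rw [Finset.sum_comm (γ := Fin p), sub_add_cancel, hr']
  rw [h2]
  refine Ideal.add_mem _ (Ideal.mem_sup_left (sum_mem fun k _ ↦
    Submodule.smul_of_tower_mem _ _ (hw k))) (Ideal.mem_sup_right (sum_mem fun j _ ↦ ?_))
  rw [Algebra.smul_def]
  exact Ideal.mul_mem_right _ _ (Ideal.mem_map_of_mem _ (sum_mem fun i _ ↦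
    Ideal.mul_mem_right _ _ (hm i)))

end FlatModulo

/-! ### Stalks of ideal sheaves, and local rings of closed subschemes and fibres. -/

namespace AlgebraicGeometry.Scheme

variable {X Y : Scheme.{u}}

lemma exists_affineOpens_le {x : X} {U : X.Opens} (hx : x ∈ U) :
    ∃ V : X.affineOpens, x ∈ V.1 ∧ V.1 ≤ U := by
  obtain ⟨V, hV, h1, h2⟩ := exists_isAffineOpen_mem_and_subset hx
  exact ⟨⟨V, hV⟩, h1, h2⟩

lemma SpecMap_fromSpecStalk_app {x : X} {R : CommRingCat.{u}} (φ : X.presheaf.stalk x ⟶ R)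
    {U : X.Opens} (hxU : x ∈ U) :
    (Spec.map φ ≫ X.fromSpecStalk x).app U = X.presheaf.germ U x hxU ≫ φ ≫
      (ΓSpecIso R).inv ≫ (Spec R).presheaf.map (homOfLE le_top).op := by
  rw [Scheme.Hom.comp_app, fromSpecStalk_app hxU, Category.assoc, Category.assoc,
    Scheme.Hom.naturality, reassoc_of% ΓSpecIso_inv_naturality φ]
  rfl

/-- The preimage of `U` in the spectrum of the local ring contains the closed point, so it is
everything and no information is lost by restricting. -/
lemma apply_germ_eq_zero_of_SpecMap_fromSpecStalk_app {x : X} {R : CommRingCat.{u}}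
    (φ : X.presheaf.stalk x ⟶ R) {U : X.Opens} (hxU : x ∈ U) {s : Γ(X, U)}
    (hs : (Spec.map φ ≫ X.fromSpecStalk x).app U s = 0) : φ (X.presheaf.germ U x hxU s) = 0 := by
  have hU : X.fromSpecStalk x ⁻¹ᵁ U = ⊤ :=
    preimage_eq_top_of_closedPoint_mem _ (by rwa [fromSpecStalk_closedPoint])
  have hU' : ⊤ ≤ (Spec.map φ ≫ X.fromSpecStalk x) ⁻¹ᵁ U := by
    change ⊤ ≤ Spec.map φ ⁻¹ᵁ (X.fromSpecStalk x ⁻¹ᵁ U)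
    rw [hU]
    rfl
  have h3 : (Spec R).presheaf.map (homOfLE (show (Spec.map φ ≫ X.fromSpecStalk x) ⁻¹ᵁ U ≤ ⊤
      from le_top)).op ≫ (Spec R).presheaf.map (homOfLE hU').op =
      𝟙 ((Spec R).presheaf.obj (.op ⊤)) := by
    rw [← Functor.map_comp, ← op_comp]
    exact (Spec R).presheaf.map_id _
  have h4 : X.presheaf.germ U x hxU ≫ φ = (Spec.map φ ≫ X.fromSpecStalk x).app U ≫
      (Spec R).presheaf.map (homOfLE hU').op ≫ (ΓSpecIso R).hom := by
    rw [SpecMap_fromSpecStalk_app φ hxU, Category.assoc, Category.assoc, Category.assoc]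
    erw [reassoc_of% h3]
    rw [Iso.inv_hom_id, Category.comp_id]
  refine congr($(h4).hom s).trans ?_
  rw [CommRingCat.hom_comp, RingHom.comp_apply]
  erw [hs]
  rw [map_zero]

/-- A preimmersion is a topological embedding, so the neighbourhood of `x` on which the pulled back
section vanishes is the preimage of an open set of `Y`. -/
lemma Hom.exists_app_eq_zero_of_stalkMap_eq_zero (f : X ⟶ Y) [IsPreimmersion f] (x : X)
    {r : Y.presheaf.stalk (f x)} (hr : f.stalkMap x r = 0) :
    ∃ (U : Y.Opens) (hU : f x ∈ U) (s : Γ(Y, U)),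
      Y.presheaf.germ U (f x) hU s = r ∧ f.app U s = 0 := by
  obtain ⟨U, hU, s, rfl⟩ := Y.presheaf.exists_germ_eq r
  have hr : (Y.presheaf.germ U _ hU ≫ f.stalkMap x).hom s = 0 := hr
  rw [Scheme.Hom.germ_stalkMap] at hr
  obtain ⟨W, hW, i, i', h⟩ := X.presheaf.germ_eq x (U := f ⁻¹ᵁ U)
    (V := f ⁻¹ᵁ U) hU hU (f.app U s) 0 (hr.trans (map_zero _).symm)
  obtain ⟨W, rfl⟩ : ∃ W', f ⁻¹ᵁ W' = W := by
    obtain ⟨W', hW', h⟩ := f.isEmbedding.isOpen_iff.mp W.2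
    exact ⟨⟨W', hW'⟩, TopologicalSpace.Opens.ext h⟩
  refine ⟨U ⊓ W, ⟨hU, hW⟩, Y.presheaf.map (homOfLE inf_le_left).op s, ?_, ?_⟩
  · exact TopCat.Presheaf.germ_res_apply Y.presheaf (homOfLE inf_le_left) (f x) _ s
  · have h5 : Y.presheaf.map (homOfLE (inf_le_left : U ⊓ W ≤ U)).op ≫ f.app (U ⊓ W) =
        f.app U ≫ X.presheaf.map i.op ≫
          X.presheaf.map (homOfLE (f.preimage_mono (inf_le_right : U ⊓ W ≤ W))).op := by
      rw [Scheme.Hom.naturality, ← Functor.map_comp]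
      rfl
    refine congr($(h5).hom s).trans ?_
    simp only [CommRingCat.hom_comp, RingHom.comp_apply]
    rw [map_zero] at h
    erw [h]
    exact map_zero _

namespace IdealSheafData

variable (I J : X.IdealSheafData)

lemma map_mem_ideal {U V : X.affineOpens} (h : U.1 ≤ V.1) {s : Γ(X, V)} (hs : s ∈ I.ideal V) :
    X.presheaf.map (homOfLE h).op s ∈ I.ideal U := by
  rw [← I.map_ideal' (homOfLE h).op]
  exact Ideal.mem_map_of_mem _ hs

/-- The ideal of the local ring at `x` consisting of the germs of sections of an ideal sheaf. -/
def stalkIdeal (x : X) : Ideal (X.presheaf.stalk x) where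
  carrier := {r | ∃ (U : X.affineOpens) (hx : x ∈ U.1), ∃ s ∈ I.ideal U,
    X.presheaf.germ U.1 x hx s = r}
  zero_mem' := by
    obtain ⟨U, hU, -⟩ := exists_affineOpens_le (X := X) (x := x) (U := ⊤) trivial
    exact ⟨U, hU, 0, zero_mem _, map_zero _⟩
  add_mem' := by
    rintro _ _ ⟨U, hxU, s, hs, rfl⟩ ⟨V, hxV, s', hs', rfl⟩
    obtain ⟨W, hxW, hW⟩ := exists_affineOpens_le (X := X) (x := x) (U := U.1 ⊓ V.1) ⟨hxU, hxV⟩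
    refine ⟨W, hxW, _, add_mem (I.map_mem_ideal (V := U) (hW.trans inf_le_left) hs)
      (I.map_mem_ideal (V := V) (hW.trans inf_le_right) hs'), ?_⟩
    rw [map_add, TopCat.Presheaf.germ_res_apply, TopCat.Presheaf.germ_res_apply]
  smul_mem' := by
    rintro r _ ⟨U, hxU, s, hs, rfl⟩
    obtain ⟨V, hxV, r, rfl⟩ := X.presheaf.exists_germ_eq r
    obtain ⟨W, hxW, hW⟩ := exists_affineOpens_le (X := X) (x := x) (U := U.1 ⊓ V) ⟨hxU, hxV⟩
    refine ⟨W, hxW, _, Ideal.mul_mem_left _ (X.presheaf.map (homOfLE (hW.trans inf_le_right)).op r)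
      (I.map_mem_ideal (V := U) (hW.trans inf_le_left) hs), ?_⟩
    rw [map_mul, TopCat.Presheaf.germ_res_apply, TopCat.Presheaf.germ_res_apply]
    rfl

variable {I J}

lemma germ_mem_stalkIdeal {x : X} {U : X.affineOpens} (hx : x ∈ U.1) {s : Γ(X, U)}
    (hs : s ∈ I.ideal U) : X.presheaf.germ U.1 x hx s ∈ I.stalkIdeal x :=
  ⟨U, hx, s, hs, rfl⟩

variable (I) in
lemma stalkIdeal_eq_map {x : X} {U : X.affineOpens} (hx : x ∈ U.1) :
    I.stalkIdeal x = (I.ideal U).map (X.presheaf.germ U.1 x hx).hom := by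
  refine le_antisymm ?_ (Ideal.map_le_iff_le_comap.mpr fun s hs ↦ germ_mem_stalkIdeal hx hs)
  rintro _ ⟨V, hxV, s, hs, rfl⟩
  obtain ⟨W, hxW, hW⟩ := exists_affineOpens_le (X := X) (x := x) (U := U.1 ⊓ V) ⟨hx, hxV⟩
  have h1 := I.map_mem_ideal (V := V) (hW.trans inf_le_right) hs
  rw [← I.map_ideal' (V := U) (homOfLE (hW.trans inf_le_left)).op] at h1
  have h2 := Ideal.mem_map_of_mem (X.presheaf.germ W.1 x hxW).hom h1
  rw [Ideal.map_map, ← CommRingCat.hom_comp, TopCat.Presheaf.germ_res] at h2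
  have h3 := TopCat.Presheaf.germ_res_apply X.presheaf (homOfLE (hW.trans inf_le_right)) x hxW s
  rw [← h3]
  exact h2

lemma stalkIdeal_mono (h : I ≤ J) (x : X) : I.stalkIdeal x ≤ J.stalkIdeal x := by
  rintro _ ⟨V, hxV, s, hs, rfl⟩
  exact germ_mem_stalkIdeal hxV (h V hs)

lemma stalkIdeal_sup (x : X) : (I ⊔ J).stalkIdeal x = I.stalkIdeal x ⊔ J.stalkIdeal x := by
  obtain ⟨U, hU, -⟩ := exists_affineOpens_le (X := X) (x := x) (U := ⊤) trivial
  simp [stalkIdeal_eq_map _ hU, Ideal.map_sup]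

lemma stalkIdeal_inf (x : X) : (I ⊓ J).stalkIdeal x = I.stalkIdeal x ⊓ J.stalkIdeal x := by
  refine le_antisymm (le_inf (stalkIdeal_mono inf_le_left x) (stalkIdeal_mono inf_le_right x)) ?_
  rintro _ ⟨⟨U, hxU, s, hs, rfl⟩, ⟨V, hxV, s', hs', h⟩⟩
  obtain ⟨W, hxW, i, i', h⟩ := X.presheaf.germ_eq x hxV hxU _ _ h
  obtain ⟨W', hxW', hW'⟩ := exists_affineOpens_le hxW
  refine ⟨W', hxW', X.presheaf.map (homOfLE (hW'.trans i'.le)).op s,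
    ⟨I.map_mem_ideal (V := U) (hW'.trans i'.le) hs, ?_⟩, ?_⟩
  · have := congr(X.presheaf.map (homOfLE hW').op $h)
    rw [← ConcreteCategory.comp_apply, ← ConcreteCategory.comp_apply, ← Functor.map_comp,
      ← Functor.map_comp] at this
    refine (congr($this ∈ J.ideal W')).mp (J.map_mem_ideal (V := V) (hW'.trans i.le) hs')
  · rw [TopCat.Presheaf.germ_res_apply]

/-- `φ` on germs factors through `Γ(X, U) ⧸ I(U)`, hence the morphism factors through the closed
subscheme. With `stalkIdeal_le_ker`, stalks of ideals can be compared by morphisms from spectra of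
quotients of the local ring. -/
lemma le_ker_SpecMap_fromSpecStalk {x : X} {R : CommRingCat.{u}} (φ : X.presheaf.stalk x ⟶ R)
    (h : I.stalkIdeal x ≤ RingHom.ker φ.hom) : I ≤ (Spec.map φ ≫ X.fromSpecStalk x).ker := by
  obtain ⟨U, hU, -⟩ := exists_affineOpens_le (X := X) (x := x) (U := ⊤) trivial
  let ψ : CommRingCat.of (Γ(X, U) ⧸ I.ideal U) ⟶ R := CommRingCat.ofHom
    (Ideal.Quotient.lift _ (X.presheaf.germ U.1 x hU ≫ φ).hom
      fun s hs ↦ h (germ_mem_stalkIdeal hU hs))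
  have h1 : X.presheaf.germ U.1 x hU ≫ φ =
    CommRingCat.ofHom (Ideal.Quotient.mk (I.ideal U)) ≫ ψ := rfl
  let c : Spec (.of (Γ(X, U) ⧸ I.ideal U)) ⟶ I.subscheme := I.subschemeCover.f U
  have hc : c ≫ I.subschemeι =
      Spec.map (CommRingCat.ofHom (Ideal.Quotient.mk (I.ideal U))) ≫ U.2.fromSpec :=
    (I.subschemeCover_map_subschemeι U).trans (I.glueDataObjι_ι U)
  have : Spec.map φ ≫ X.fromSpecStalk x = (Spec.map ψ ≫ c) ≫ I.subschemeι := by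
    rw [Category.assoc, hc, ← U.2.fromSpecStalk_eq_fromSpecStalk hU]
    change Spec.map φ ≫ Spec.map (X.presheaf.germ U.1 x hU) ≫ U.2.fromSpec = _
    rw [← Category.assoc, ← Category.assoc, ← Spec.map_comp, ← Spec.map_comp, h1]
  rw [this]
  conv_lhs => rw [← I.ker_subschemeι]
  exact Hom.le_ker_comp _ _

lemma stalkIdeal_le_ker {x : X} {R : CommRingCat.{u}} (φ : X.presheaf.stalk x ⟶ R)
    (h : I ≤ (Spec.map φ ≫ X.fromSpecStalk x).ker) : I.stalkIdeal x ≤ RingHom.ker φ.hom := by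
  rintro _ ⟨U, hxU, s, hs, rfl⟩
  exact apply_germ_eq_zero_of_SpecMap_fromSpecStalk_app φ hxU (Hom.ideal_ker_le _ _ (h U hs))

lemma _root_.CommRingCat.exists_surjective_ker_eq (A : CommRingCat.{u}) (I : Ideal A) :
    ∃ (R : CommRingCat.{u}) (φ : A ⟶ R), Function.Surjective φ ∧ RingHom.ker φ.hom = I :=
  ⟨.of (A ⧸ I), CommRingCat.ofHom (Ideal.Quotient.mk I), Ideal.Quotient.mk_surjective, Ideal.mk_ker⟩

/-- Each inclusion is tested on the quotient of the local ring by the larger ideal, where the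
adjunction of `comap` and `map` turns it into a statement about kernels of morphisms. -/
lemma stalkIdeal_comap (I : Y.IdealSheafData) (f : X ⟶ Y) (x : X) :
    (I.comap f).stalkIdeal x = (I.stalkIdeal (f x)).map (f.stalkMap x).hom := by
  refine le_antisymm ?_ ?_
  · obtain ⟨R, φ, -, hφ⟩ := CommRingCat.exists_surjective_ker_eq (X.presheaf.stalk x)
      ((I.stalkIdeal (f x)).map (f.stalkMap x).hom)
    rw [← hφ]
    refine stalkIdeal_le_ker _ ?_
    rw [← map_bot, le_map_iff_comap_le, ← comap_comp, ← le_map_iff_comap_le, map_bot,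
      Category.assoc, ← SpecMap_stalkMap_fromSpecStalk, ← Spec.map_comp_assoc]
    refine le_ker_SpecMap_fromSpecStalk _ ?_
    rw [CommRingCat.hom_comp, ← RingHom.comap_ker, hφ]
    exact Ideal.le_comap_map
  · obtain ⟨R, φ, -, hφ⟩ := CommRingCat.exists_surjective_ker_eq (X.presheaf.stalk x)
      ((I.comap f).stalkIdeal x)
    rw [Ideal.map_le_iff_le_comap]
    refine (stalkIdeal_le_ker (f.stalkMap x ≫ φ) ?_).trans ?_
    · rw [Spec.map_comp, Category.assoc, SpecMap_stalkMap_fromSpecStalk, ← Category.assoc,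
        ← map_bot, le_map_iff_comap_le, comap_comp, ← le_map_iff_comap_le, map_bot]
      exact le_ker_SpecMap_fromSpecStalk _ hφ.ge
    · rw [CommRingCat.hom_comp, ← RingHom.comap_ker, hφ]

lemma ker_stalkMap_subschemeι (z : I.subscheme) :
    RingHom.ker (I.subschemeι.stalkMap z).hom = I.stalkIdeal (I.subschemeι z) := by
  refine le_antisymm (fun r hr ↦ ?_) ?_
  · obtain ⟨U, hU, s, rfl, hs⟩ := I.subschemeι.exists_app_eq_zero_of_stalkMap_eq_zero z hr
    obtain ⟨V, hV, hVU⟩ := exists_affineOpens_le hU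
    refine ⟨V, hV, X.presheaf.map (homOfLE hVU).op s, ?_, ?_⟩
    · rw [← ker_subschemeι_app, RingHom.mem_ker]
      have h5 := I.subschemeι.naturality (homOfLE hVU).op
      refine congr($(h5).hom s).trans ?_
      rw [CommRingCat.hom_comp, RingHom.comp_apply]
      erw [hs]
      exact map_zero _
    · rw [TopCat.Presheaf.germ_res_apply]
  · rintro _ ⟨U, hU, s, hs, rfl⟩
    have : I.subschemeι.app U.1 s = 0 := by
      rwa [← RingHom.mem_ker, ker_subschemeι_app]
    rw [RingHom.mem_ker]
    change (X.presheaf.germ U.1 _ hU ≫ I.subschemeι.stalkMap z).hom s = 0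
    rw [Scheme.Hom.germ_stalkMap]
    change (I.subscheme.presheaf.germ _ z hU) (I.subschemeι.app U.1 s) = 0
    rw [this, map_zero]

end IdealSheafData

lemma _root_.CommRingCat.exists_residue_comp_eq {A R : CommRingCat.{u}} [IsLocalRing A]
    (φ : A ⟶ R) (h : IsLocalRing.maximalIdeal A ≤ RingHom.ker φ.hom) :
    ∃ ψ : CommRingCat.of (IsLocalRing.ResidueField A) ⟶ R,
      CommRingCat.ofHom (IsLocalRing.residue A) ≫ ψ = φ :=
  ⟨CommRingCat.ofHom (Ideal.Quotient.lift (IsLocalRing.maximalIdeal A) φ.hom h), rfl⟩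

lemma Hom.apply_fiberι (f : X ⟶ Y) (y : Y) (x : f.fiber y) : f (f.fiberι y x) = y := by
  have : f.fiberι y x ∈ f ⁻¹' {y} := by rw [← f.range_fiberι]; exact ⟨x, rfl⟩
  exact this

/-- The local ring of a fibre is the quotient of the local ring of the total space by the maximal
ideal of the local ring of the base. -/
lemma Hom.ker_stalkMap_fiberι (f : X ⟶ Y) (y : Y) (x : f.fiber y) :
    RingHom.ker ((f.fiberι y).stalkMap x).hom =
      (IsLocalRing.maximalIdeal (Y.presheaf.stalk (f (f.fiberι y x)))).map
        (f.stalkMap (f.fiberι y x)).hom := by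
  have hy := f.apply_fiberι y x
  refine le_antisymm ?_ ?_
  · obtain ⟨R, φ, -, hφ⟩ := CommRingCat.exists_surjective_ker_eq (X.presheaf.stalk (f.fiberι y x))
      ((IsLocalRing.maximalIdeal (Y.presheaf.stalk (f (f.fiberι y x)))).map
        (f.stalkMap (f.fiberι y x)).hom)
    obtain ⟨ψ, hψ⟩ : ∃ ψ : Y.residueField (f (f.fiberι y x)) ⟶ R,
        Y.residue _ ≫ ψ = f.stalkMap (f.fiberι y x) ≫ φ :=
      CommRingCat.exists_residue_comp_eq _ fun a ha ↦ hφ.ge (Ideal.mem_map_of_mem _ ha)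
    -- With `R = 𝒪_{X,x} ⧸ 𝔪𝒪_{X,x}`, the map from `Spec R` to `Y` passes through the residue field,
    -- so `Spec R` lifts to the fibre and a section vanishing on the fibre vanishes in `R`.
    let l : Spec R ⟶ f.fiber y := pullback.lift (Spec.map φ ≫ X.fromSpecStalk (f.fiberι y x))
      (Spec.map ψ ≫ Spec.map (Y.residueFieldCongr hy.symm).hom) (by
        rw [Category.assoc, Category.assoc, residueFieldCongr_fromSpecResidueField,
          fromSpecResidueField, ← SpecMap_stalkMap_fromSpecStalk, ← Category.assoc,
          ← Category.assoc, ← Spec.map_comp, ← Spec.map_comp, hψ])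
    have hl : l ≫ f.fiberι y = Spec.map φ ≫ X.fromSpecStalk (f.fiberι y x) :=
      pullback.lift_fst _ _ _
    intro r hr
    obtain ⟨U, hU, s, rfl, hs⟩ := (f.fiberι y).exists_app_eq_zero_of_stalkMap_eq_zero x hr
    rw [← hφ]
    refine apply_germ_eq_zero_of_SpecMap_fromSpecStalk_app φ hU ?_
    rw [← hl, Scheme.Hom.comp_app]
    change l.app _ ((f.fiberι y).app U s) = 0
    erw [hs]
    exact map_zero _
  · rw [Ideal.map_le_iff_le_comap]
    intro a ha
    obtain ⟨U, hU, s, rfl⟩ := Y.presheaf.exists_germ_eq a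
    have hy' : y ∈ U := hy ▸ hU
    have hs : (Y.fromSpecResidueField y).app U s = 0 := by
      rw [fromSpecResidueField, SpecMap_fromSpecStalk_app _ hy']
      have : Y.evaluation U y hy' s = 0 := by
        rw [evaluation_eq_zero_iff_notMem_basicOpen]
        have : f (f.fiberι y x) ∉ Y.basicOpen s := by
          rw [← evaluation_eq_zero_iff_notMem_basicOpen _ _ hU]
          exact Ideal.Quotient.eq_zero_iff_mem.mpr ha
        rwa [hy] at this
      rw [germ_residue_assoc, CommRingCat.comp_apply, this, map_zero]
    have h1 : (f.fiberι y ≫ f).app U s = 0 := by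
      rw [f.fiber_fac, Scheme.Hom.comp_app]
      change (f.fiberToSpecResidueField y).app _ ((Y.fromSpecResidueField y).app U s) = 0
      erw [hs]
      exact map_zero _
    have h2 : ((f.fiberι y ≫ f).stalkMap x) (Y.presheaf.germ U _ hU s) = 0 := by
      refine (Scheme.Hom.germ_stalkMap_apply (f.fiberι y ≫ f) U x hU s).trans ?_
      erw [h1]
      exact map_zero _
    rw [Scheme.Hom.stalkMap_comp] at h2
    exact h2

end AlgebraicGeometry.Scheme

/-! ### Morphisms of sheaves of modules tested on stalks. -/

noncomputable section

namespace OppositeSES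

variable {X Y : Scheme.{u}} {M N K : X.Modules}

/-- The germ at `x` of a section of an `𝒪_X`-module, as an additive map. -/
def germ (M : X.Modules) {U : X.Opens} {x : X} (hx : x ∈ U) : Γ(M, U) →+ stalkAt M x :=
  (TopCat.Presheaf.germ (C := Ab) M.presheaf U x hx).hom

/-- Restriction of sections of an `𝒪_X`-module. -/
def res (M : X.Modules) {U V : X.Opens} (h : V ≤ U) : Γ(M, U) →+ Γ(M, V) :=
  (M.presheaf.map (homOfLE h).op).hom

lemma germ_res {U V : X.Opens} (h : V ≤ U) {x : X} (hx : x ∈ V) (m : Γ(M, U)) :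
    germ M hx (res M h m) = germ M (h hx) m :=
  TopCat.Presheaf.germ_res_apply (C := Ab) M.presheaf (homOfLE h) x hx m

lemma germ_smul {U : X.Opens} {x : X} (hx : x ∈ U) (r : Γ(X, U)) (m : Γ(M, U)) :
    germ M hx (r • m) = X.presheaf.germ U x hx r • germ M hx m :=
  PresheafOfModules.germ_smul (R := X.presheaf) M.val x U hx r m

lemma exists_germ_eq {x : X} (m : stalkAt M x) :
    ∃ (U : X.Opens) (hx : x ∈ U) (s : Γ(M, U)), germ M hx s = m :=
  TopCat.Presheaf.exists_germ_eq (C := Ab) M.presheaf m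

lemma exists_res_eq_zero {x : X} {U : X.Opens} (hx : x ∈ U) {s : Γ(M, U)} (h : germ M hx s = 0) :
    ∃ (V : X.Opens) (hVU : V ≤ U), x ∈ V ∧ res M hVU s = 0 := by
  obtain ⟨V, hV, i, i', h⟩ := TopCat.Presheaf.germ_eq (C := Ab) M.presheaf x hx hx s 0
    (h.trans (map_zero _).symm)
  exact ⟨V, i.le, hV, h.trans (map_zero _)⟩

lemma eq_zero_of_germ {U : X.Opens} {s : Γ(M, U)} (h : ∀ x (hx : x ∈ U), germ M hx s = 0) :
    s = 0 :=
  TopCat.Presheaf.section_ext (C := Ab) ⟨M.presheaf, M.isSheaf⟩ U s 0 fun x hx ↦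
    (h x hx).trans (map_zero _).symm

/-- The morphism induced on stalks by a morphism of `𝒪_X`-modules. -/
def stalkMap (φ : M ⟶ N) (x : X) : stalkAt M x →ₗ[X.presheaf.stalk x] stalkAt N x where
  toFun := ((TopCat.Presheaf.stalkFunctor Ab x).map φ.mapPresheaf).hom
  map_add' := map_add _
  map_smul' r m := by
    obtain ⟨U, hU, m, rfl⟩ := exists_germ_eq m
    obtain ⟨V, hV, r, rfl⟩ := X.presheaf.exists_germ_eq r
    have hW : x ∈ U ⊓ V := ⟨hU, hV⟩
    have h (n : Γ(M, U ⊓ V)) :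
        ((TopCat.Presheaf.stalkFunctor Ab x).map φ.mapPresheaf).hom (germ M hW n) =
          germ N hW (φ.app _ n) :=
      TopCat.Presheaf.stalkFunctor_map_germ_apply (C := Ab) _ x hW φ.mapPresheaf n
    rw [← germ_res inf_le_left hW, ← TopCat.Presheaf.germ_res_apply X.presheaf
      (homOfLE inf_le_right) x hW r, ← germ_smul]
    erw [h, h]
    rw [Scheme.Modules.Hom.app_smul, germ_smul]
    rfl

lemma stalkMap_germ (φ : M ⟶ N) {x : X} {U : X.Opens} (hx : x ∈ U) (s : Γ(M, U)) :
    stalkMap φ x (germ M hx s) = germ N hx (φ.app U s) :=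
  TopCat.Presheaf.stalkFunctor_map_germ_apply (C := Ab) U x hx φ.mapPresheaf s

lemma app_res (φ : M ⟶ N) {U V : X.Opens} (h : V ≤ U) (s : Γ(M, U)) :
    φ.app V (res M h s) = res N h (φ.app U s) :=
  congr($(φ.mapPresheaf.naturality (homOfLE h).op).hom s)

lemma stalkMap_comp (φ : M ⟶ N) (ψ : N ⟶ K) (x : X) (m : stalkAt M x) :
    stalkMap (φ ≫ ψ) x m = stalkMap ψ x (stalkMap φ x m) := by
  obtain ⟨U, hU, m, rfl⟩ := exists_germ_eq m
  simp only [stalkMap_germ]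
  rfl

lemma stalkMap_zero (x : X) (m : stalkAt M x) : stalkMap (0 : M ⟶ N) x m = 0 := by
  obtain ⟨U, hU, m, rfl⟩ := exists_germ_eq m
  rw [stalkMap_germ]
  exact map_zero _

lemma eq_zero_of_stalkMap {φ : M ⟶ N} (h : ∀ x m, stalkMap φ x m = 0) : φ = 0 := by
  refine Scheme.Modules.hom_ext _ _ fun U ↦ ?_
  ext s
  refine eq_zero_of_germ fun x hx ↦ ?_
  rw [← stalkMap_germ]
  exact h _ _

lemma mono_of_stalkMap {φ : M ⟶ N} (h : ∀ x m, stalkMap φ x m = 0 → m = 0) : Mono φ := by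
  refine Preadditive.mono_of_cancel_zero _ fun g hg ↦ eq_zero_of_stalkMap fun x m ↦ ?_
  refine h x _ ?_
  rw [← stalkMap_comp, hg, stalkMap_zero]

lemma epi_of_stalkMap {φ : M ⟶ N} (h : ∀ x, Function.Surjective (stalkMap φ x)) : Epi φ := by
  refine Preadditive.epi_of_cancel_zero _ fun g hg ↦ eq_zero_of_stalkMap fun x m ↦ ?_
  obtain ⟨m, rfl⟩ := h x m
  rw [← stalkMap_comp, hg, stalkMap_zero]

lemma app_injective_of_mono (φ : M ⟶ N) [Mono φ] {U : X.Opens} {s : Γ(M, U)}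
    (h : φ.app U s = 0) : s = 0 := by
  have h1 : Mono ((Scheme.Modules.toPresheaf X).map φ) := inferInstance
  have h2 : Mono (φ.app U) := inferInstanceAs
    (Mono (((Scheme.Modules.toPresheaf X).map φ).app (.op U)))
  exact (AddCommGrpCat.mono_iff_injective (φ.app U)).mp h2 (h.trans (map_zero _).symm)

lemma stalkMap_eq_zero_of_mono (φ : M ⟶ N) [Mono φ] {x : X} {m : stalkAt M x}
    (h : stalkMap φ x m = 0) : m = 0 := by
  obtain ⟨U, hU, m, rfl⟩ := exists_germ_eq m
  rw [stalkMap_germ] at h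
  obtain ⟨V, hVU, hV, h⟩ := exists_res_eq_zero hU h
  rw [← app_res] at h
  rw [← germ_res hVU hV, app_injective_of_mono φ h, map_zero]

/-- Taking sections over `U` is left exact. -/
lemma exists_app_eq_of_isLimit {i : K ⟶ M} {φ : M ⟶ N} {w : i ≫ φ = 0}
    (hi : IsLimit (KernelFork.ofι i w)) {U : X.Opens} {s : Γ(M, U)} (hs : φ.app U s = 0) :
    ∃ t, i.app U t = s := by
  let F : X.Modules ⥤ Ab := Scheme.Modules.toPresheaf X ⋙ (evaluation _ _).obj (.op U)
  have : F.PreservesZeroMorphisms := ⟨fun _ _ ↦ rfl⟩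
  have : PreservesLimitsOfShape WalkingParallelPair
      ((evaluation X.Opensᵒᵖ Ab.{u}).obj (.op U)) := evaluation_preservesLimitsOfShape _
  have : PreservesLimitsOfShape WalkingParallelPair F := comp_preservesLimitsOfShape _ _
  have h := KernelFork.mapIsLimit _ hi F
  have hex : (ShortComplex.mk (F.map i) (F.map φ)
      (by rw [← F.map_comp, w, F.map_zero])).Exact :=
    ShortComplex.exact_of_f_is_kernel _ h
  rw [ShortComplex.ab_exact_iff] at hex
  exact hex s hs

lemma exists_stalkMap_eq_of_isLimit {i : K ⟶ M} {φ : M ⟶ N} {w : i ≫ φ = 0}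
    (hi : IsLimit (KernelFork.ofι i w)) {x : X} {m : stalkAt M x} (hm : stalkMap φ x m = 0) :
    ∃ k, stalkMap i x k = m := by
  obtain ⟨U, hU, m, rfl⟩ := exists_germ_eq m
  rw [stalkMap_germ] at hm
  obtain ⟨V, hVU, hV, h⟩ := exists_res_eq_zero hU hm
  rw [← app_res] at h
  obtain ⟨t, ht⟩ := exists_app_eq_of_isLimit hi h
  exact ⟨germ K hV t, by rw [stalkMap_germ, ht, germ_res]⟩

/-- A morphism whose images on stalks lie in those of a monomorphism factors through it. -/
lemma exists_lift_of_stalkMap (φ : M ⟶ N) [Mono φ] (ψ : K ⟶ N)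
    (h : ∀ x k, ∃ m, stalkMap φ x m = stalkMap ψ x k) : ∃ l : K ⟶ M, l ≫ φ = ψ := by
  have w : ψ ≫ cokernel.π φ = 0 := by
    refine eq_zero_of_stalkMap fun x k ↦ ?_
    obtain ⟨m, hm⟩ := h x k
    rw [stalkMap_comp, ← hm, ← stalkMap_comp, cokernel.condition, stalkMap_zero]
  exact ⟨Abelian.monoLift φ ψ w, Abelian.monoLift_comp _ _ _⟩

/-- A morphism that kills the stalks of the kernel of an epimorphism factors through it. -/
lemma exists_desc_of_stalkMap (φ : M ⟶ N) [Epi φ] (ψ : M ⟶ K)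
    (h : ∀ x m, stalkMap φ x m = 0 → stalkMap ψ x m = 0) : ∃ l : N ⟶ K, φ ≫ l = ψ := by
  have w : kernel.ι φ ≫ ψ = 0 := by
    refine eq_zero_of_stalkMap fun x k ↦ ?_
    rw [stalkMap_comp]
    refine h x _ ?_
    rw [← stalkMap_comp, kernel.condition, stalkMap_zero]
  exact ⟨Abelian.epiDesc φ ψ w, Abelian.comp_epiDesc _ _ _⟩

/-- Exactness in the middle is surjectivity of `M → ker b` on stalks, which can be checked in the
stalks of `N` because `kernel.ι b` is injective there. -/
lemma shortExact_of_stalkMap (a : M ⟶ N) (b : N ⟶ K) (w : a ≫ b = 0)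
    (ha : ∀ x m, stalkMap a x m = 0 → m = 0)
    (hab : ∀ x n, stalkMap b x n = 0 → ∃ m, stalkMap a x m = n)
    (hb : ∀ x, Function.Surjective (stalkMap b x)) : (ShortComplex.mk a b w).ShortExact := by
  have : Mono a := mono_of_stalkMap ha
  have : Epi b := epi_of_stalkMap hb
  refine ⟨?_⟩
  rw [ShortComplex.exact_iff_epi_kernel_lift]
  refine epi_of_stalkMap fun x k ↦ ?_
  obtain ⟨m, hm⟩ := hab x (stalkMap (kernel.ι b) x k)
    (by rw [← stalkMap_comp, kernel.condition, stalkMap_zero])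
  refine ⟨m, ?_⟩
  rw [← sub_eq_zero]
  apply stalkMap_eq_zero_of_mono (kernel.ι b)
  rw [map_sub, sub_eq_zero, ← stalkMap_comp, ← hm]
  congr 1
  simp

/-! ### The structure module, ideal sheaves and relative ideal sheaves on stalks. -/

/-- A section of the structure sheaf, regarded as a section of the structure module. -/
def toStructure {U : X.Opens} : Γ(X, U) →ₗ[Γ(X, U)] Γ(structureModule X, U) where
  toFun r := r
  map_add' _ _ := rfl
  map_smul' _ _ := rfl

lemma toStructure_smul_one {U : X.Opens} (r : Γ(X, U)) :
    r • toStructure (1 : Γ(X, U)) = toStructure r := by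
  rw [← map_smul, smul_eq_mul, mul_one]

lemma res_toStructure {U V : X.Opens} (h : V ≤ U) (r : Γ(X, U)) :
    res (structureModule X) h (toStructure r) =
      toStructure (X.presheaf.map (homOfLE h).op r) := rfl

lemma toPushforwardStructure_app (i : Y ⟶ X) {U : X.Opens} (r : Γ(X, U)) :
    (toPushforwardStructure i).app U (toStructure r) = toStructure (i.app U r) := rfl

/-- The identification of the local ring at `x` with the stalk of the structure module. -/
def stalkToStructure (x : X) :
    X.presheaf.stalk x →ₗ[X.presheaf.stalk x] stalkAt (structureModule X) x :=
  LinearMap.toSpanSingleton _ _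
    (germ (structureModule X) (TopologicalSpace.Opens.mem_top x) (toStructure 1))

lemma stalkToStructure_germ {x : X} {U : X.Opens} (hx : x ∈ U) (r : Γ(X, U)) :
    stalkToStructure x (X.presheaf.germ U x hx r) =
      germ (structureModule X) hx (toStructure r) := by
  rw [stalkToStructure, LinearMap.toSpanSingleton_apply, ← germ_res le_top hx, ← germ_smul,
    res_toStructure, map_one, toStructure_smul_one]

lemma stalkToStructure_surjective (x : X) : Function.Surjective (stalkToStructure x) := by
  intro m
  obtain ⟨U, hU, m, rfl⟩ := exists_germ_eq m
  exact ⟨X.presheaf.germ U x hU m, stalkToStructure_germ hU m⟩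

lemma stalkToStructure_injective (x : X) {r : X.presheaf.stalk x} (h : stalkToStructure x r = 0) :
    r = 0 := by
  obtain ⟨U, hU, r, rfl⟩ := X.presheaf.exists_germ_eq r
  rw [stalkToStructure_germ] at h
  obtain ⟨V, hVU, hV, h⟩ := exists_res_eq_zero hU h
  rw [res_toStructure] at h
  have h : X.presheaf.map (homOfLE hVU).op r = 0 := h
  rw [← TopCat.Presheaf.germ_res_apply X.presheaf (homOfLE hVU) x hV r, h, map_zero]

/-- The morphism from the structure module given by a global section. -/
def homOfSection (s : Γ(M, ⊤)) : structureModule X ⟶ M :=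
  (SheafOfModules.unitHomEquiv (R := X.ringCatSheaf) M).symm
    (PresheafOfModules.sectionsMk (M := M.val) (fun U ↦ res M (U := ⊤) (V := U.unop) le_top s)
      fun U V f ↦ by
        change (M.presheaf.map (homOfLE le_top).op ≫ M.presheaf.map f).hom s = _
        rw [← Functor.map_comp]
        rfl)

lemma homOfSection_app (s : Γ(M, ⊤)) : (homOfSection s).app ⊤ (toStructure 1) = s := by
  have h := SheafOfModules.unitHomEquiv_apply_coe (R := X.ringCatSheaf) M (homOfSection s) (.op ⊤)
  refine h.symm.trans ?_
  rw [homOfSection, Equiv.apply_symm_apply]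
  exact congr($(M.presheaf.map_id (.op ⊤)).hom s)

lemma stalkMap_homOfSection (s : Γ(M, ⊤)) (x : X) (r : X.presheaf.stalk x) :
    stalkMap (homOfSection s) x (stalkToStructure x r) =
      r • germ M (TopologicalSpace.Opens.mem_top x) s := by
  rw [stalkToStructure, LinearMap.toSpanSingleton_apply, map_smul, stalkMap_germ, homOfSection_app]

lemma exists_of_stalkMap_toPushforwardStructure (i : Y ⟶ X) {x : X} {r : X.presheaf.stalk x}
    (h : stalkMap (toPushforwardStructure i) x (stalkToStructure x r) = 0) :
    ∃ (U : X.Opens) (hx : x ∈ U) (s : Γ(X, U)), X.presheaf.germ U x hx s = r ∧ i.app U s = 0 := by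
  obtain ⟨U, hU, r, rfl⟩ := X.presheaf.exists_germ_eq r
  rw [stalkToStructure_germ, stalkMap_germ] at h
  obtain ⟨V, hVU, hV, h⟩ := exists_res_eq_zero hU h
  rw [← app_res, res_toStructure, toPushforwardStructure_app] at h
  exact ⟨V, hV, _, TopCat.Presheaf.germ_res_apply X.presheaf (homOfLE hVU) x hV r, h⟩

lemma stalkMap_toPushforwardStructure_of_app (i : Y ⟶ X) {x : X} {U : X.Opens} (hx : x ∈ U)
    {s : Γ(X, U)} (hs : i.app U s = 0) : stalkMap (toPushforwardStructure i) x
      (stalkToStructure x (X.presheaf.germ U x hx s)) = 0 := by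
  rw [stalkToStructure_germ, stalkMap_germ, toPushforwardStructure_app, hs, map_zero]
  exact map_zero _

lemma exists_app_subschemeι_iff (I : X.IdealSheafData) {x : X} {r : X.presheaf.stalk x} :
    (∃ (U : X.Opens) (hx : x ∈ U) (s : Γ(X, U)), X.presheaf.germ U x hx s = r ∧
      I.subschemeι.app U s = 0) ↔ r ∈ I.stalkIdeal x := by
  constructor
  · rintro ⟨U, hx, s, rfl, hs⟩
    obtain ⟨V, hV, hVU⟩ := Scheme.exists_affineOpens_le hx
    refine ⟨V, hV, X.presheaf.map (homOfLE hVU).op s, ?_,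
      TopCat.Presheaf.germ_res_apply X.presheaf (homOfLE hVU) x hV s⟩
    rw [← Scheme.IdealSheafData.ker_subschemeι_app, RingHom.mem_ker]
    have h5 := I.subschemeι.naturality (homOfLE hVU).op
    refine congr($(h5).hom s).trans ?_
    rw [CommRingCat.hom_comp, RingHom.comp_apply]
    erw [hs]
    exact map_zero _
  · rintro ⟨U, hx, s, hs, rfl⟩
    refine ⟨U, hx, s, rfl, ?_⟩
    rwa [← RingHom.mem_ker, Scheme.IdealSheafData.ker_subschemeι_app]

lemma stalkMap_toPushforwardStructure_eq_zero_iff (I : X.IdealSheafData) {x : X}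
    {r : X.presheaf.stalk x} :
    stalkMap (toPushforwardStructure I.subschemeι) x (stalkToStructure x r) = 0 ↔
      r ∈ I.stalkIdeal x := by
  rw [← exists_app_subschemeι_iff]
  refine ⟨exists_of_stalkMap_toPushforwardStructure _, ?_⟩
  rintro ⟨U, hx, s, rfl, hs⟩
  exact stalkMap_toPushforwardStructure_of_app _ hx hs

/-- The inclusion of the ideal sheaf in the structure module. -/
def idealSheafι (i : Y ⟶ X) : idealSheaf i ⟶ structureModule X :=
  kernel.ι (toPushforwardStructure i)

lemma idealSheafι_comp (i : Y ⟶ X) : idealSheafι i ≫ toPushforwardStructure i = 0 :=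
  kernel.condition _

instance (i : Y ⟶ X) : Mono (idealSheafι i) :=
  inferInstanceAs (Mono (kernel.ι (toPushforwardStructure i)))

/-- The ideal sheaf is the kernel of the morphism to the structure sheaf of the subscheme. -/
def idealSheafIsKernel (i : Y ⟶ X) : IsLimit (KernelFork.ofι _ (idealSheafι_comp i)) :=
  kernelIsKernel (toPushforwardStructure i)

lemma exists_idealSheafι_app_eq (i : Y ⟶ X) {U : X.Opens} {s : Γ(X, U)} (hs : i.app U s = 0) :
    ∃ t, (idealSheafι i).app U t = toStructure s := by
  refine exists_app_eq_of_isLimit (idealSheafIsKernel i) ?_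
  rw [toPushforwardStructure_app, hs]
  exact map_zero _

lemma exists_stalkMap_idealSheafι (I : X.IdealSheafData) {x : X}
    (m : stalkAt (idealSheaf I.subschemeι) x) :
    ∃ r ∈ I.stalkIdeal x, stalkMap (idealSheafι I.subschemeι) x m = stalkToStructure x r := by
  obtain ⟨r, hr⟩ := stalkToStructure_surjective x (stalkMap (idealSheafι _) x m)
  refine ⟨r, ?_, hr.symm⟩
  rw [← stalkMap_toPushforwardStructure_eq_zero_iff, hr, ← stalkMap_comp, idealSheafι_comp,
    stalkMap_zero]

lemma exists_stalkMap_idealSheafι_eq {I : X.IdealSheafData} {x : X} {r : X.presheaf.stalk x}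
    (hr : r ∈ I.stalkIdeal x) :
    ∃ m, stalkMap (idealSheafι I.subschemeι) x m = stalkToStructure x r :=
  exists_stalkMap_eq_of_isLimit (idealSheafIsKernel _)
    ((stalkMap_toPushforwardStructure_eq_zero_iff I).mpr hr)

lemma stalkMap_idealSheafι_injective (i : Y ⟶ X) (x : X) :
    Function.Injective (stalkMap (idealSheafι i) x) :=
  (injective_iff_map_eq_zero _).mpr fun _ ↦ stalkMap_eq_zero_of_mono _

/-- The stalk of the ideal sheaf of a closed subscheme. -/
def stalkIdealEquiv (I : X.IdealSheafData) (x : X) :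
    I.stalkIdeal x ≃ₗ[X.presheaf.stalk x] stalkAt (idealSheaf I.subschemeι) x :=
  (LinearEquiv.ofInjective (stalkToStructure x ∘ₗ (I.stalkIdeal x).subtype)
      ((injective_iff_map_eq_zero _).mpr fun r hr ↦
        Subtype.ext (stalkToStructure_injective x hr))) ≪≫ₗ
    LinearEquiv.ofEq _ _ (by
      ext m
      constructor
      · rintro ⟨r, rfl⟩
        exact exists_stalkMap_idealSheafι_eq r.2
      · rintro ⟨m, rfl⟩
        obtain ⟨r, hr, h⟩ := exists_stalkMap_idealSheafι I m
        exact ⟨⟨r, hr⟩, h.symm⟩) ≪≫ₗ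
    (LinearEquiv.ofInjective _ (stalkMap_idealSheafι_injective I.subschemeι x)).symm

/-- The inclusion of the relative ideal sheaf in the pushforward of the structure module. -/
def relativeIdealSheafι {W Z : X.IdealSheafData} (h : W ≤ Z) :
    relativeIdealSheaf h ⟶
      (Scheme.Modules.pushforward W.subschemeι).obj (structureModule W.subscheme) :=
  (Scheme.Modules.pushforward W.subschemeι).map (idealSheafι _)

lemma relativeIdealSheafι_comp {W Z : X.IdealSheafData} (h : W ≤ Z) :
    relativeIdealSheafι h ≫ (Scheme.Modules.pushforward W.subschemeι).map
      (toPushforwardStructure (Scheme.IdealSheafData.inclusion h)) = 0 :=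
  ((Scheme.Modules.pushforward W.subschemeι).map_comp _ _).symm.trans
    (congr((Scheme.Modules.pushforward W.subschemeι).map $(idealSheafι_comp _)).trans
      (Functor.map_zero _ _ _))

/-- The relative ideal sheaf is a kernel. -/
def relativeIdealSheafIsKernel {W Z : X.IdealSheafData} (h : W ≤ Z) :
    IsLimit (KernelFork.ofι _ (relativeIdealSheafι_comp h)) :=
  KernelFork.mapIsLimit _ (idealSheafIsKernel _) (Scheme.Modules.pushforward W.subschemeι)

instance {W Z : X.IdealSheafData} (h : W ≤ Z) : Mono (relativeIdealSheafι h) :=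
  mono_of_isLimit_fork (relativeIdealSheafIsKernel h)

lemma stalkMap_toPushforwardStructure_subschemeι_surjective (I : X.IdealSheafData) (x : X) :
    Function.Surjective (stalkMap (toPushforwardStructure I.subschemeι) x) := by
  intro m
  obtain ⟨U, hU, m, rfl⟩ := exists_germ_eq m
  obtain ⟨V, hV, hVU⟩ := Scheme.exists_affineOpens_le hU
  obtain ⟨s, hs⟩ := I.subschemeι_app_surjective V (res _ hVU m)
  refine ⟨germ _ hV (toStructure s), ?_⟩
  rw [stalkMap_germ, toPushforwardStructure_app, hs, ← germ_res hVU hV]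
  rfl

/-- The ideal sheaf of the smaller subscheme surjects onto the relative ideal sheaf, with the
ideal of the larger subscheme as its kernel. -/
lemma exists_idealSheaf_to_relativeIdealSheaf {W Z : X.IdealSheafData} (h : W ≤ Z) :
    ∃ e : idealSheaf Z.subschemeι ⟶ relativeIdealSheaf h,
      (∀ x, Function.Surjective (stalkMap e x)) ∧
      ∀ x m r, stalkMap (idealSheafι Z.subschemeι) x m = stalkToStructure x r →
        (stalkMap e x m = 0 ↔ r ∈ W.stalkIdeal x) := by
  -- Mapping a germ to `𝒪_W` and on to `𝒪_Z` is restriction to `Z`, since the inclusion of `Z` in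
  -- `X` factors through `W`.
  have key (x : X) (r : X.presheaf.stalk x) :
      stalkMap ((Scheme.Modules.pushforward W.subschemeι).map
        (toPushforwardStructure (Scheme.IdealSheafData.inclusion h))) x
        (stalkMap (toPushforwardStructure W.subschemeι) x (stalkToStructure x r)) = 0 ↔
      r ∈ Z.stalkIdeal x := by
    rw [← exists_app_subschemeι_iff, ← Scheme.IdealSheafData.inclusion_subschemeι h]
    constructor
    · intro hr
      obtain ⟨U, hU, r, rfl⟩ := X.presheaf.exists_germ_eq r
      rw [stalkToStructure_germ, stalkMap_germ, stalkMap_germ] at hr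
      obtain ⟨V, hVU, hV, hr⟩ := exists_res_eq_zero hU hr
      rw [← app_res, ← app_res, res_toStructure] at hr
      exact ⟨V, hV, _, TopCat.Presheaf.germ_res_apply X.presheaf (homOfLE hVU) x hV r, hr⟩
    · rintro ⟨U, hx, s, rfl, hs⟩
      rw [stalkToStructure_germ, stalkMap_germ, stalkMap_germ]
      refine Eq.trans ?_ (map_zero (germ _ hx))
      exact congr(germ _ hx $hs)
  obtain ⟨e, he⟩ := exists_lift_of_stalkMap (relativeIdealSheafι h)
    (idealSheafι Z.subschemeι ≫ toPushforwardStructure W.subschemeι) (by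
      intro x m
      obtain ⟨r, hr, hm⟩ := exists_stalkMap_idealSheafι Z m
      refine exists_stalkMap_eq_of_isLimit (relativeIdealSheafIsKernel h) ?_
      rw [stalkMap_comp, hm, key]
      exact hr)
  have he' (x : X) (m) : stalkMap (relativeIdealSheafι h) x (stalkMap e x m) =
      stalkMap (toPushforwardStructure W.subschemeι) x (stalkMap (idealSheafι _) x m) := by
    rw [← stalkMap_comp, he, stalkMap_comp]
  refine ⟨e, fun x k ↦ ?_, fun x m r hm ↦ ?_⟩
  · obtain ⟨r, hr⟩ := stalkMap_toPushforwardStructure_subschemeι_surjective W x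
      (stalkMap (relativeIdealSheafι h) x k)
    obtain ⟨r, rfl⟩ := stalkToStructure_surjective x r
    have hr' : r ∈ Z.stalkIdeal x := by
      rw [← key, hr, ← stalkMap_comp, relativeIdealSheafι_comp, stalkMap_zero]
    obtain ⟨m, hm⟩ := exists_stalkMap_idealSheafι_eq hr'
    refine ⟨m, sub_eq_zero.mp (stalkMap_eq_zero_of_mono (relativeIdealSheafι h) ?_)⟩
    rw [map_sub, sub_eq_zero, he', hm, hr]
  · rw [← stalkMap_toPushforwardStructure_eq_zero_iff, ← hm, ← he']
    exact ⟨fun h ↦ by rw [h, map_zero], stalkMap_eq_zero_of_mono _⟩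

/-! ### Comparison of stalks under pushforward and pullback. -/

lemma mem_preimage {f : X ⟶ Y} {x : X} {U : Y.Opens} (hx : f x ∈ U) : x ∈ f ⁻¹ᵁ U := hx

/-- The canonical map from a stalk of a pushforward to the corresponding stalk of the module. -/
def pushforwardStalk (f : X ⟶ Y) (N : X.Modules) (x : X) :
    stalkAt ((Scheme.Modules.pushforward f).obj N) (f x) →+ stalkAt N x :=
  (TopCat.Presheaf.stalkPushforward Ab f.base N.presheaf x).hom

lemma pushforwardStalk_germ (f : X ⟶ Y) (N : X.Modules) {x : X} {U : Y.Opens} (hx : f x ∈ U)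
    (s : Γ(N, f ⁻¹ᵁ U)) :
    pushforwardStalk f N x (germ ((Scheme.Modules.pushforward f).obj N) hx s) =
      germ N (mem_preimage hx) s :=
  congr($(TopCat.Presheaf.stalkPushforward_germ Ab f.base N.presheaf U x hx).hom s)

/-- The canonical map from sections of a module to sections of its pullback. -/
def pullbackSection (f : X ⟶ Y) (M : Y.Modules) (U : Y.Opens) :
    Γ(M, U) →+ Γ((Scheme.Modules.pullback f).obj M, f ⁻¹ᵁ U) :=
  (((Scheme.Modules.pullbackPushforwardAdjunction f).unit.app M).app U).hom

lemma pullbackSection_smul (f : X ⟶ Y) (M : Y.Modules) {U : Y.Opens} (r : Γ(Y, U)) (m : Γ(M, U)) :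
    pullbackSection f M U (r • m) = f.app U r • pullbackSection f M U m :=
  Scheme.Modules.Hom.app_smul ((Scheme.Modules.pullbackPushforwardAdjunction f).unit.app M) r m

lemma app_pullbackSection (f : X ⟶ Y) {M N : Y.Modules} (φ : M ⟶ N) {U : Y.Opens} (m : Γ(M, U)) :
    ((Scheme.Modules.pullback f).map φ).app (f ⁻¹ᵁ U) (pullbackSection f M U m) =
      pullbackSection f N U (φ.app U m) :=
  congr(($((Scheme.Modules.pullbackPushforwardAdjunction f).unit.naturality φ).app U).hom m).symm

lemma app_homEquiv_symm (f : X ⟶ Y) {M : Y.Modules} {N : X.Modules}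
    (φ : M ⟶ (Scheme.Modules.pushforward f).obj N) {U : Y.Opens} (m : Γ(M, U)) :
    (((Scheme.Modules.pullbackPushforwardAdjunction f).homEquiv _ _).symm φ).app (f ⁻¹ᵁ U)
      (pullbackSection f M U m) = φ.app U m := by
  have h := ((Scheme.Modules.pullbackPushforwardAdjunction f).homEquiv _ _).apply_symm_apply φ
  rw [Adjunction.homEquiv_unit] at h
  exact congr(($(h).app U).hom m)

/-- The canonical map from a stalk of a module to a stalk of its pullback. -/
def pullbackStalk (f : X ⟶ Y) (M : Y.Modules) (x : X) :
    stalkAt M (f x) →ₛₗ[(f.stalkMap x).hom] stalkAt ((Scheme.Modules.pullback f).obj M) x where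
  toFun m := pushforwardStalk f _ x
    (stalkMap ((Scheme.Modules.pullbackPushforwardAdjunction f).unit.app M) (f x) m)
  map_add' _ _ := by simp only [map_add]
  map_smul' r m := by
    obtain ⟨U, hU, m, rfl⟩ := exists_germ_eq m
    obtain ⟨V, hV, r, rfl⟩ := Y.presheaf.exists_germ_eq r
    have hW : f x ∈ U ⊓ V := ⟨hU, hV⟩
    have h (n : Γ(M, U ⊓ V)) : pushforwardStalk f _ x
        (stalkMap ((Scheme.Modules.pullbackPushforwardAdjunction f).unit.app M) (f x)
          (germ M hW n)) = germ _ (mem_preimage hW) (pullbackSection f M _ n) := by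
      exact congr(pushforwardStalk f _ x $(stalkMap_germ _ hW n)).trans
        (pushforwardStalk_germ _ _ _ _)
    rw [← germ_res inf_le_left hW, ← TopCat.Presheaf.germ_res_apply Y.presheaf
      (homOfLE inf_le_right) (f x) hW r, ← germ_smul, h, h, pullbackSection_smul, germ_smul]
    congr 1
    exact (Scheme.Hom.germ_stalkMap_apply f (U ⊓ V) x hW _).symm

lemma pullbackStalk_germ (f : X ⟶ Y) (M : Y.Modules) {x : X} {U : Y.Opens} (hx : f x ∈ U)
    (m : Γ(M, U)) : pullbackStalk f M x (germ M hx m) =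
      germ _ (mem_preimage hx) (pullbackSection f M U m) := by
  refine Eq.trans ?_ (pushforwardStalk_germ f _ hx _)
  exact congr(pushforwardStalk f _ x $(stalkMap_germ _ hx m))

lemma stalkMap_pullback_map (f : X ⟶ Y) {M N : Y.Modules} (φ : M ⟶ N) {x : X}
    (m : stalkAt M (f x)) :
    stalkMap ((Scheme.Modules.pullback f).map φ) x (pullbackStalk f M x m) =
      pullbackStalk f N x (stalkMap φ (f x) m) := by
  obtain ⟨U, hU, m, rfl⟩ := exists_germ_eq m
  rw [pullbackStalk_germ, stalkMap_germ, stalkMap_germ, pullbackStalk_germ, app_pullbackSection]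

lemma stalkMap_homEquiv_symm (f : X ⟶ Y) {M : Y.Modules} {N : X.Modules}
    (φ : M ⟶ (Scheme.Modules.pushforward f).obj N) {x : X} (m : stalkAt M (f x)) :
    stalkMap (((Scheme.Modules.pullbackPushforwardAdjunction f).homEquiv _ _).symm φ) x
      (pullbackStalk f M x m) = pushforwardStalk f N x (stalkMap φ (f x) m) := by
  obtain ⟨U, hU, m, rfl⟩ := exists_germ_eq m
  rw [pullbackStalk_germ, stalkMap_germ, stalkMap_germ, app_homEquiv_symm]
  exact (pushforwardStalk_germ _ _ _ _).symm

/-! ### Skyscraper modules, used as test objects for the stalks of a pullback. -/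

section Skyscraper

variable (x : X) (Q : Type u) [AddCommGroup Q]

/-- The sections over `U` of the skyscraper module at `x` with value `Q`. -/
def SkyscraperSection (U : X.Opens) : Type u := PLift (x ∈ U) → Q

instance (U : X.Opens) : AddCommGroup (SkyscraperSection x Q U) :=
  inferInstanceAs (AddCommGroup (PLift (x ∈ U) → Q))

instance [Module (X.presheaf.stalk x) Q] (U : X.Opens) :
    Module Γ(X, U) (SkyscraperSection x Q U) where
  smul r φ := fun h ↦ X.presheaf.germ U x h.down r • φ h
  one_smul φ := funext fun h ↦ by
    change X.presheaf.germ U x h.down 1 • φ h = φ h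
    rw [map_one, one_smul]
  mul_smul r s φ := funext fun h ↦ by
    change X.presheaf.germ U x h.down (r * s) • φ h = _
    rw [map_mul, mul_smul]
    rfl
  smul_zero r := funext fun h ↦ smul_zero (X.presheaf.germ U x h.down r)
  smul_add r φ ψ := funext fun h ↦ smul_add (X.presheaf.germ U x h.down r) (φ h) (ψ h)
  add_smul r s φ := funext fun h ↦ by
    change X.presheaf.germ U x h.down (r + s) • φ h = _
    rw [map_add, add_smul]
    rfl
  zero_smul φ := funext fun h ↦ by
    change X.presheaf.germ U x h.down 0 • φ h = 0
    rw [map_zero, zero_smul]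

/-- The abelian presheaf underlying the skyscraper module. -/
def skyscraperAb : X.Opensᵒᵖ ⥤ Ab.{u} where
  obj U := .of (SkyscraperSection x Q U.unop)
  map f := AddCommGrpCat.ofHom
    { toFun φ := fun h ↦ φ ⟨f.unop.le h.down⟩
      map_zero' := rfl
      map_add' _ _ := rfl }

instance [Module (X.presheaf.stalk x) Q] (U : X.Opensᵒᵖ) :
    Module (X.ringCatSheaf.obj.obj U) ((skyscraperAb x Q).obj U) :=
  inferInstanceAs (Module Γ(X, U.unop) (SkyscraperSection x Q U.unop))

lemma isSheaf_skyscraperAb : TopCat.Presheaf.IsSheaf (C := Ab.{u}) (X := X) (skyscraperAb x Q) := by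
  rw [TopCat.Presheaf.isSheaf_iff_isSheaf_comp (CategoryTheory.forget Ab.{u}),
    TopCat.Presheaf.isSheaf_iff_isSheafUniqueGluing_types]
  intro ι U s hs
  have key {i j : ι} (hi : x ∈ U i) (hj : x ∈ U j) : s i ⟨hi⟩ = s j ⟨hj⟩ :=
    congr_fun (hs i j) ⟨⟨hi, hj⟩⟩
  refine ⟨fun h ↦ s (TopologicalSpace.Opens.mem_iSup.mp h.down).choose
    ⟨(TopologicalSpace.Opens.mem_iSup.mp h.down).choose_spec⟩, ?_, ?_⟩
  · intro i
    exact funext fun h ↦ key _ h.down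
  · intro t ht
    refine funext fun h ↦ ?_
    exact congr_fun (ht (TopologicalSpace.Opens.mem_iSup.mp h.down).choose)
      ⟨(TopologicalSpace.Opens.mem_iSup.mp h.down).choose_spec⟩

variable [Module (X.presheaf.stalk x) Q]

/-- The skyscraper module at `x` with value `Q`. -/
def skyscraper : X.Modules where
  val := PresheafOfModules.ofPresheaf (skyscraperAb x Q) (by
    intro U V f r φ
    refine funext fun h ↦ ?_
    have h1 := TopCat.Presheaf.germ_res_apply X.presheaf f.unop x h.down r
    exact congr($h1.symm • φ ⟨f.unop.le h.down⟩))
  isSheaf := isSheaf_skyscraperAb x Q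

/-- The value at `x` of a section of a skyscraper module. -/
def skyscraperEval {U : X.Opens} (hx : x ∈ U) : Γ(skyscraper x Q, U) →+ Q where
  toFun φ := (show SkyscraperSection x Q U from φ) ⟨hx⟩
  map_zero' := rfl
  map_add' _ _ := rfl

lemma skyscraperEval_res {U V : X.Opens} (h : V ≤ U) (hx : x ∈ V) (s : Γ(skyscraper x Q, U)) :
    skyscraperEval x Q hx (res _ h s) = skyscraperEval x Q (h hx) s := rfl

variable {Q}

/-- The morphism to a skyscraper module given by a linear map on the stalk. -/
def toSkyscraper (M : X.Modules) (g : stalkAt M x →ₗ[X.presheaf.stalk x] Q) :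
    M ⟶ skyscraper x Q where
  val := PresheafOfModules.homMk
    { app U := AddCommGrpCat.ofHom
        { toFun m := (fun h ↦ g (germ M (U := U.unop) h.down m) : SkyscraperSection x Q U.unop)
          map_zero' := funext fun h ↦
            congr(g $(map_zero (germ M (U := U.unop) h.down))).trans (map_zero g)
          map_add' m n := funext fun h ↦
            congr(g $(map_add (germ M (U := U.unop) h.down) m n)).trans (map_add g _ _) }
      naturality U V i := by
        ext m
        refine funext fun h ↦ ?_
        exact congr(g $(germ_res i.unop.le h.down m)) } (by
    intro U r m
    refine funext fun h ↦ ?_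
    refine congr(g $(germ_smul (U := U.unop) h.down r m)).trans ?_
    exact g.map_smul _ _)

lemma skyscraperEval_toSkyscraper (M : X.Modules) (g : stalkAt M x →ₗ[X.presheaf.stalk x] Q)
    {U : X.Opens} (hx : x ∈ U) (m : Γ(M, U)) :
    skyscraperEval x Q hx ((toSkyscraper x M g).app U m) = g (germ M hx m) := rfl

/-- The morphism to the pushforward of a skyscraper module given by a semilinear map on the
stalk. -/
def toPushforwardSkyscraper (f : X ⟶ Y) (M : Y.Modules)
    (g : stalkAt M (f x) →ₛₗ[(f.stalkMap x).hom] Q) :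
    M ⟶ (Scheme.Modules.pushforward f).obj (skyscraper x Q) where
  val := PresheafOfModules.homMk
    { app U := AddCommGrpCat.ofHom
        { toFun m := (fun h ↦ g (germ M (U := U.unop) h.down m) :
            SkyscraperSection x Q (f ⁻¹ᵁ U.unop))
          map_zero' := funext fun h ↦
            congr(g $(map_zero (germ M (U := U.unop) h.down))).trans (map_zero g)
          map_add' m n := funext fun h ↦
            congr(g $(map_add (germ M (U := U.unop) h.down) m n)).trans (map_add g _ _) }
      naturality U V i := by
        ext m
        refine funext fun h ↦ ?_
        exact congr(g $(germ_res i.unop.le h.down m)) } (by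
    intro U r m
    refine funext fun h ↦ ?_
    refine congr(g $(germ_smul (U := U.unop) h.down r m)).trans ?_
    refine (g.map_smulₛₗ _ _).trans ?_
    exact congr($(Scheme.Hom.germ_stalkMap_apply f U.unop x h.down r) • g (germ M h.down m)))

lemma skyscraperEval_toPushforwardSkyscraper (f : X ⟶ Y) (M : Y.Modules)
    (g : stalkAt M (f x) →ₛₗ[(f.stalkMap x).hom] Q) {U : Y.Opens} (hx : f x ∈ U) (m : Γ(M, U)) :
    skyscraperEval x Q (mem_preimage hx) ((toPushforwardSkyscraper x f M g).app U m) =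
      g (germ M hx m) := rfl

end Skyscraper

/-- The target is `M ⧸ (ker φ) M`, a `B`-module through `A ⧸ ker φ ≅ B`. -/
lemma _root_.RingHom.exists_semilinear_ker_le {A B : Type u} [CommRing A] [CommRing B] (φ : A →+* B)
    (hφ : Function.Surjective φ) (M : Type u) [AddCommGroup M] [Module A M] :
    ∃ (Q : Type u) (_ : AddCommGroup Q) (_ : Module B Q) (g : M →ₛₗ[φ] Q),
      ∀ m, g m = 0 → m ∈ RingHom.ker φ • (⊤ : Submodule A M) := by
  let ψ := (RingHom.quotientKerEquivOfSurjective hφ).symm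
  let _ : Module B (M ⧸ RingHom.ker φ • (⊤ : Submodule A M)) := Module.compHom _ ψ.toRingHom
  refine ⟨M ⧸ RingHom.ker φ • (⊤ : Submodule A M), inferInstance, inferInstance,
    { toFun := Submodule.mkQ _
      map_add' := map_add _
      map_smul' a m := ?_ }, fun m hm ↦ (Submodule.Quotient.mk_eq_zero _).mp hm⟩
  have : ψ (φ a) = Ideal.Quotient.mk _ a := by
    rw [RingEquiv.symm_apply_eq]
    rfl
  change _ = ψ (φ a) • Submodule.mkQ (RingHom.ker φ • (⊤ : Submodule A M)) m
  rw [this]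
  rfl

/-- If `𝒪_{Y,f(x)} → 𝒪_{X,x}` is surjective, then so is `M_{f(x)} → (f^* M)_x`. -/
lemma pullbackStalk_surjective (f : X ⟶ Y) (M : Y.Modules) {x : X}
    (h : Function.Surjective (f.stalkMap x).hom) : Function.Surjective (pullbackStalk f M x) := by
  have : RingHomSurjective (f.stalkMap x).hom := ⟨h⟩
  let p := (LinearMap.range (pullbackStalk f M x)).mkQ
  -- The quotient by the image defines a map from the pullback to a skyscraper. Its adjoint sees
  -- only germs in that image, so it is zero, and the quotient map vanishes on every germ.
  have hψ : toSkyscraper x _ p = 0 := by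
    apply ((Scheme.Modules.pullbackPushforwardAdjunction f).homEquiv _ _).injective
    rw [Adjunction.homEquiv_unit, Adjunction.homEquiv_unit, Functor.map_zero, comp_zero]
    refine Scheme.Modules.hom_ext _ _ fun U ↦ ?_
    ext m
    refine funext fun hx ↦ ?_
    refine (skyscraperEval_toSkyscraper x _ p hx.down (pullbackSection f M U m)).trans ?_
    rw [← pullbackStalk_germ f M hx.down]
    exact (Submodule.Quotient.mk_eq_zero _).mpr (LinearMap.mem_range_self _ _)
  intro n
  obtain ⟨U, hU, n, rfl⟩ := exists_germ_eq n
  have h1 := skyscraperEval_toSkyscraper x _ p hU n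
  rw [hψ] at h1
  exact (Submodule.Quotient.mk_eq_zero _).mp h1.symm

/-- If `𝒪_{Y,f(x)} → 𝒪_{X,x}` is surjective with kernel `𝔞`, then the kernel of
`M_{f(x)} → (f^* M)_x` is `𝔞 M_{f(x)}`. -/
lemma pullbackStalk_eq_zero_iff (f : X ⟶ Y) (M : Y.Modules) {x : X}
    (h : Function.Surjective (f.stalkMap x).hom) {m : stalkAt M (f x)} :
    pullbackStalk f M x m = 0 ↔ m ∈ RingHom.ker (f.stalkMap x).hom •
      (⊤ : Submodule (Y.presheaf.stalk (f x)) (stalkAt M (f x))) := by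
  constructor
  · intro hm
    -- By adjunction `g` extends to a morphism from the pullback to a skyscraper; a germ that dies
    -- in the pullback is therefore killed by `g`.
    obtain ⟨Q, _, _, g, hg⟩ := (f.stalkMap x).hom.exists_semilinear_ker_le h (stalkAt M (f x))
    apply hg
    obtain ⟨U, hU, m, rfl⟩ := exists_germ_eq m
    rw [pullbackStalk_germ] at hm
    obtain ⟨V, hVU, hV, hm⟩ := exists_res_eq_zero _ hm
    rw [← skyscraperEval_toPushforwardSkyscraper, ← app_homEquiv_symm,
      ← skyscraperEval_res x Q hVU hV, ← app_res, hm, map_zero, map_zero]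
  · intro hm
    refine Submodule.smul_induction_on hm (fun r hr m _ ↦ ?_) fun m n hm hn ↦ ?_
    · rw [LinearMap.map_smulₛₗ, RingHom.mem_ker.mp hr, zero_smul]
    · rw [map_add, hm, hn, add_zero]

end OppositeSES
end

/-! ### The local algebra of the two subschemes, and flatness over the base. -/

noncomputable section

/-- The algebraic situation in the local rings of a flat family at a point of two closed
subschemes with ideals `I` and `J`, the first flat over the base and the second flat over the
divisor with equation `t`. -/
structure IsFlatPair {A R : Type*} [CommRing A] [CommRing R] [Algebra A R] (t : A)
    (I J : Ideal R) : Prop where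
  flat : Module.Flat A R
  mem_nonZeroDivisors : t ∈ nonZeroDivisors A
  algebraMap_mem : algebraMap A R t ∈ J
  flatModulo_left : FlatModulo (0 : A) I
  flatModulo_right : FlatModulo t J
  exists_add_smul : ∀ j ∈ J, ∃ i ∈ I, ∃ r, j = i + t • r

namespace AlgebraicGeometry.Scheme

variable {X S : Scheme.{u}}

namespace IdealSheafData

lemma stalkIdeal_eq_top_or (I : X.IdealSheafData) (x : X) :
    I.stalkIdeal x = ⊤ ∨ ∃ z, I.subschemeι z = x := by
  by_cases hx : x ∈ I.support
  · right
    have : x ∈ Set.range I.subschemeι := by rwa [I.range_subschemeι]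
    exact this
  · left
    obtain ⟨U, hU, -⟩ := exists_affineOpens_le (X := X) (x := x) (U := ⊤) trivial
    rw [I.mem_support_iff_of_mem hU] at hx
    simp only [Scheme.mem_zeroLocus_iff, not_forall, not_not] at hx
    obtain ⟨f, hf, hx⟩ := hx
    refine Ideal.eq_top_of_isUnit_mem _ (germ_mem_stalkIdeal hU hf) ?_
    exact (X.mem_basicOpen f x hU).mp hx

/-- The image of `z` is often only provably equal to the point at hand; the specialization map moves
the stalk. -/
lemma stalkMap_subschemeι_of_eq (I : X.IdealSheafData) (z : I.subscheme) {x : X}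
    (h : I.subschemeι z = x) :
    Function.Surjective (X.presheaf.stalkSpecializes (specializes_of_eq h) ≫
      I.subschemeι.stalkMap z).hom ∧
    RingHom.ker (X.presheaf.stalkSpecializes (specializes_of_eq h) ≫
      I.subschemeι.stalkMap z).hom = I.stalkIdeal x := by
  subst h
  rw [TopCat.Presheaf.stalkSpecializes_refl, Category.id_comp]
  exact ⟨I.subschemeι.stalkMap_surjective z, ker_stalkMap_subschemeι z⟩

end IdealSheafData

lemma germ_mem_nonZeroDivisors {U : X.affineOpens} {x : X} (hx : x ∈ U.1) {t : Γ(X, U)}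
    (ht : t ∈ nonZeroDivisors Γ(X, U)) :
    X.presheaf.germ U.1 x hx t ∈ nonZeroDivisors (X.presheaf.stalk x) := by
  let _ : Algebra Γ(X, U) (X.presheaf.stalk x) := (X.presheaf.germ U.1 x hx).hom.toAlgebra
  have := U.2.isLocalization_stalk ⟨x, hx⟩
  exact IsLocalization.nonZeroDivisors_le_comap (U.2.primeIdealOf ⟨x, hx⟩).asIdeal.primeCompl
    (X.presheaf.stalk x) ht

/-- At a point outside a subscheme its ideal is the unit ideal and its flatness condition is
vacuous. At a point on it, the quotient is the local ring of the subscheme, whose flatness is the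
hypothesis. -/
lemma isFlatPair_stalkIdeal (p : X ⟶ S) [Flat p] (Y V : X.IdealSheafData) (E : S.IdealSheafData)
    (hY : Flat (Y.subschemeι ≫ p)) (hVE : E.comap p ≤ V)
    (hV : Flat (IdealSheafData.subschemeMap V E p (IdealSheafData.le_map_iff_comap_le.mpr hVE)))
    (hYV : V ≤ Y ⊔ E.comap p) {U : S.affineOpens} {t : Γ(S, U)}
    (ht : t ∈ nonZeroDivisors Γ(S, U)) (hE : E.ideal U = Ideal.span {t}) (x : X) (hx : p x ∈ U.1) :
    letI := (p.stalkMap x).hom.toAlgebra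
    IsFlatPair (S.presheaf.germ U.1 (p x) hx t) (Y.stalkIdeal x) (V.stalkIdeal x) := by
  let _ := (p.stalkMap x).hom.toAlgebra
  have hE' : E.stalkIdeal (p x) = Ideal.span {S.presheaf.germ U.1 (p x) hx t} := by
    rw [IdealSheafData.stalkIdeal_eq_map E hx, hE, Ideal.map_span, Set.image_singleton]
  have hE'' : (E.comap p).stalkIdeal x =
      Ideal.span {algebraMap _ _ (S.presheaf.germ U.1 (p x) hx t)} := by
    rw [IdealSheafData.stalkIdeal_comap, hE', Ideal.map_span, Set.image_singleton]
    rfl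
  refine ⟨Flat.stalkMap p x, germ_mem_nonZeroDivisors hx ht, ?_, ?_, ?_, ?_⟩
  · apply IdealSheafData.stalkIdeal_mono hVE x
    rw [hE'']
    exact Ideal.mem_span_singleton_self _
  · obtain h | ⟨z, rfl⟩ := Y.stalkIdeal_eq_top_or x
    · rw [h]
      exact FlatModulo.top _
    · refine FlatModulo.of_flat (A := S.presheaf.stalk (p (Y.subschemeι z))) (RingHom.id _)
        ((Y.subschemeι ≫ p).stalkMap z).hom
        (Y.subschemeι.stalkMap z).hom (fun a ↦ ?_) 0 _ Function.surjective_id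
        (fun a ha ↦ ⟨0, ha.trans (mul_zero _).symm⟩) (Y.subschemeι.stalkMap_surjective z)
        (IdealSheafData.ker_stalkMap_subschemeι z) (Flat.stalkMap _ z)
      rw [Scheme.Hom.stalkMap_comp]
      rfl
  · obtain h | ⟨z, rfl⟩ := V.stalkIdeal_eq_top_or x
    · rw [h]
      exact FlatModulo.top _
    · let m := IdealSheafData.subschemeMap V E p (IdealSheafData.le_map_iff_comap_le.mpr hVE)
      have hm : m ≫ E.subschemeι = V.subschemeι ≫ p :=
        IdealSheafData.subschemeMap_subschemeι _ _ _ _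
      have hz : E.subschemeι (m z) = p (V.subschemeι z) :=
        congr($(hm) z)
      obtain ⟨h1, h2⟩ := E.stalkMap_subschemeι_of_eq (m z) hz
      refine FlatModulo.of_flat _ (m.stalkMap z).hom (V.subschemeι.stalkMap z).hom (fun a ↦ ?_)
        _ _ h1 (fun a ha ↦ ?_) (V.subschemeι.stalkMap_surjective z)
        (IdealSheafData.ker_stalkMap_subschemeι z) (Flat.stalkMap _ z)
      · have h3 := Scheme.Hom.stalkMap_congr_hom _ _ hm.symm z
        rw [Scheme.Hom.stalkMap_comp, Scheme.Hom.stalkMap_comp] at h3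
        exact congr($(h3).hom a).symm
      · rw [← RingHom.mem_ker, h2, hE', Ideal.mem_span_singleton'] at ha
        obtain ⟨c, hc⟩ := ha
        exact ⟨c, by rw [mul_comm, hc]⟩
  · intro j hj
    have hj := IdealSheafData.stalkIdeal_mono hYV x hj
    rw [IdealSheafData.stalkIdeal_sup, hE''] at hj
    obtain ⟨i, hi, k, hk, rfl⟩ := Submodule.mem_sup.mp hj
    obtain ⟨r, rfl⟩ := Ideal.mem_span_singleton'.mp hk
    exact ⟨i, hi, r, by rw [Algebra.smul_def, mul_comm]⟩

end AlgebraicGeometry.Scheme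

namespace OppositeSES

lemma isFlatOver_idealSheaf {X S : Scheme.{u}} (p : X ⟶ S) [Flat p] (Y V : X.IdealSheafData)
    (E : S.IdealSheafData) (hE : IsCartierDivisor E)
    (hY : Flat (Y.subschemeι ≫ p)) (hVE : E.comap p ≤ V)
    (hV : Flat (Scheme.IdealSheafData.subschemeMap V E p
      (Scheme.IdealSheafData.le_map_iff_comap_le.mpr hVE)))
    (hYV : V ≤ Y ⊔ E.comap p) : IsFlatOver p (idealSheaf (Y ⊓ V).subschemeι) := by
  intro x
  obtain ⟨U, hU, t, ht, hEU⟩ := hE (p x)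
  let _ := (p.stalkMap x).hom.toAlgebra
  have h := Scheme.isFlatPair_stalkIdeal p Y V E hY hVE hV hYV ht hEU x hU
  have := h.flat
  let _ : Module (S.presheaf.stalk (p x)) (stalkAt (idealSheaf (Y ⊓ V).subschemeι) x) :=
    Module.compHom _ (p.stalkMap x).hom
  have h1 := FlatModulo.inf_flat_of_flat h.mem_nonZeroDivisors h.algebraMap_mem h.flatModulo_left
    h.exists_add_smul h.flatModulo_right
  rw [← Scheme.IdealSheafData.stalkIdeal_inf] at h1
  let e := stalkIdealEquiv (Y ⊓ V) x
  let e' : ((Y ⊓ V).stalkIdeal x) ≃ₗ[S.presheaf.stalk (p x)]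
      stalkAt (idealSheaf (Y ⊓ V).subschemeι) x :=
    { e with
      map_smul' a m := by
        have : a • m = p.stalkMap x a • m := by
          ext
          simp [Algebra.smul_def]
          rfl
        rw [this]
        exact e.map_smul _ _ }
  exact Module.Flat.of_linearEquiv e'.symm

end OppositeSES
end

/-! ### The local algebra at a point of a fibre over the divisor. -/

noncomputable section

/-- The relations between the ideals `I`, `J` of two closed subschemes, the equation `τ` of a
divisor and the ideal `𝔞` of a fibre that control the fibre of the ideal `I ⊓ J`. -/
structure IsFiberPair {R : Type*} [CommRing R] (𝔞 I J : Ideal R) (τ : R) : Prop where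
  mem_right : τ ∈ J
  mem_fiber : τ ∈ 𝔞
  mem_mul_inf : ∀ z ∈ I, z ∈ 𝔞 * J → z ∈ 𝔞 * (I ⊓ J)
  exists_sub_mem : ∀ z ∈ I ⊓ J, z ∈ 𝔞 → ∃ i ∈ I, z - i * τ ∈ 𝔞 * (I ⊓ J)
  mem_sup : ∀ r, r * τ ∈ 𝔞 * J → r ∈ J ⊔ 𝔞
  exists_sub_mem_left : ∀ j ∈ J, ∃ r, j - r * τ ∈ I

/-- The subtle property is `exists_sub_mem`: `FlatModulo.exists_of_mem_map` gives a multiple `t r`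
of `t`, but `r` need not be in `I`. -/
lemma IsFlatPair.isFiberPair {A R : Type*} [CommRing A] [CommRing R] [Algebra A R] {t : A}
    {I J : Ideal R} (h : IsFlatPair t I J) {𝔪 : Ideal A} (ht : t ∈ 𝔪) :
    IsFiberPair (𝔪.map (algebraMap A R)) I J (algebraMap A R t) := by
  have := h.flat
  have h1 (z) (hz : z ∈ I) (hz' : z ∈ 𝔪.map (algebraMap A R) * J) :
      z ∈ 𝔪.map (algebraMap A R) * (I ⊓ J) :=
    FlatModulo.mem_mul_inf_of_mem h.mem_nonZeroDivisors h.algebraMap_mem h.flatModulo_left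
      h.exists_add_smul hz hz'
  refine ⟨h.algebraMap_mem, Ideal.mem_map_of_mem _ ht, h1, fun z hz hz' ↦ ?_, fun r hr ↦ ?_,
    fun j hj ↦ ?_⟩
  · obtain ⟨r, hr⟩ := h.flatModulo_right.exists_of_mem_map hz.2 hz'
    have h2 : 𝔪.map (algebraMap A R) * J ≤
        I ⊔ 𝔪.map (algebraMap A R) * Ideal.span {algebraMap A R t} := by
      rw [Ideal.mul_le]
      intro a ha j hj
      obtain ⟨i, hi, r, rfl⟩ := h.exists_add_smul j hj
      rw [mul_add, Algebra.smul_def]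
      exact add_mem (Ideal.mem_sup_left (I.mul_mem_left _ hi)) (Ideal.mem_sup_right
        (Ideal.mul_mem_mul ha (Ideal.mul_mem_right _ _ (Ideal.mem_span_singleton_self _))))
    obtain ⟨i, hi, k, hk, hik⟩ := Submodule.mem_sup.mp (h2 hr)
    obtain ⟨a, ha, rfl⟩ := Ideal.mem_mul_span_singleton.mp hk
    rw [Algebra.smul_def] at hr hik
    -- As `z - t r ∈ 𝔪J` has the form `i + a t` with `i ∈ I` and `a ∈ 𝔪R`, changing `r` by `a`
    -- brings it into `I` and changes `t r` only within `𝔪J`.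
    have h3 : r + a ∈ I := by
      refine h.flatModulo_left.mul_mem h.mem_nonZeroDivisors ?_
      rw [Algebra.smul_def, show algebraMap A R t * (r + a) = z - i by linear_combination hik]
      exact sub_mem hz.1 hi
    refine ⟨r + a, h3, h1 _ (sub_mem hz.1 (I.mul_mem_right _ h3)) ?_⟩
    rw [show z - (r + a) * algebraMap A R t =
      (z - algebraMap A R t * r) - a * algebraMap A R t by ring]
    exact sub_mem hr (Ideal.mul_mem_mul ha h.algebraMap_mem)
  · refine h.flatModulo_right.exists_of_smul_mem h.mem_nonZeroDivisors ?_
    rwa [Algebra.smul_def, mul_comm (algebraMap A R t)]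
  · obtain ⟨i, hi, r, rfl⟩ := h.exists_add_smul j hj
    exact ⟨r, by rwa [Algebra.smul_def, mul_comm r, add_sub_cancel_right]⟩

namespace AlgebraicGeometry.Scheme

variable {X S : Scheme.{u}}

namespace IdealSheafData

lemma stalkIdeal_le_maximalIdeal {I : X.IdealSheafData} {x : X} (hx : x ∈ I.support) :
    I.stalkIdeal x ≤ IsLocalRing.maximalIdeal (X.presheaf.stalk x) := by
  rintro _ ⟨U, hU, s, hs, rfl⟩
  rw [I.mem_support_iff_of_mem hU, Scheme.mem_zeroLocus_iff] at hx
  exact fun h ↦ hx s hs ((X.mem_basicOpen s x hU).mpr h)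

lemma comap_fromSpecResidueField {I : X.IdealSheafData} {x : X} (hx : x ∈ I.support) :
    I.comap (X.fromSpecResidueField x) = ⊥ := by
  rw [eq_bot_iff, ← le_map_iff_comap_le, map_bot]
  refine le_ker_SpecMap_fromSpecStalk _ ((stalkIdeal_le_maximalIdeal hx).trans ?_)
  exact (Ideal.mk_ker (I := IsLocalRing.maximalIdeal (X.presheaf.stalk x))).ge

/-- A fibre over a point of `E` lies in the preimage of `E`. -/
lemma comap_comap_fiberι {E : S.IdealSheafData} (p : X ⟶ S) {ξ : S} (hξ : ξ ∈ E.support) :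
    (E.comap p).comap (p.fiberι ξ) = ⊥ := by
  rw [← comap_comp, p.fiber_fac, comap_comp, comap_fromSpecResidueField hξ, comap_bot]

end IdealSheafData

lemma isFiberPair_stalkIdeal (p : X ⟶ S) [Flat p] (Y V : X.IdealSheafData) (E : S.IdealSheafData)
    (hY : Flat (Y.subschemeι ≫ p)) (hVE : E.comap p ≤ V)
    (hV : Flat (IdealSheafData.subschemeMap V E p (IdealSheafData.le_map_iff_comap_le.mpr hVE)))
    (hYV : V ≤ Y ⊔ E.comap p) {U : S.affineOpens} {t : Γ(S, U)}
    (ht : t ∈ nonZeroDivisors Γ(S, U)) (hE : E.ideal U = Ideal.span {t}) {ξ : S}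
    (hξ : ξ ∈ E.support) (x : p.fiber ξ) (hx : p.fiberι ξ x ∈ p ⁻¹ᵁ U.1) :
    IsFiberPair (RingHom.ker ((p.fiberι ξ).stalkMap x).hom) (Y.stalkIdeal (p.fiberι ξ x))
      (V.stalkIdeal (p.fiberι ξ x)) (X.presheaf.germ _ _ hx (p.app U t)) := by
  let _ := (p.stalkMap (p.fiberι ξ x)).hom.toAlgebra
  have h := isFlatPair_stalkIdeal p Y V E hY hVE hV hYV ht hE (p.fiberι ξ x) hx
  rw [p.ker_stalkMap_fiberι, ← p.germ_stalkMap_apply U.1 (p.fiberι ξ x) hx t]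
  refine h.isFiberPair (𝔪 := IsLocalRing.maximalIdeal _) ?_
  refine IdealSheafData.stalkIdeal_le_maximalIdeal (I := E) ?_
    (IdealSheafData.germ_mem_stalkIdeal hx (hE ▸ Ideal.mem_span_singleton_self t))
  rwa [p.apply_fiberι]

end AlgebraicGeometry.Scheme

/-! ### Stalks of the pullback of an ideal sheaf. -/

namespace OppositeSES

variable {X Y : Scheme.{u}}

lemma stalkMap_stalkIdealEquiv (I : X.IdealSheafData) (x : X) (r : I.stalkIdeal x) :
    stalkMap (idealSheafι I.subschemeι) x (stalkIdealEquiv I x r) = stalkToStructure x r.1 := by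
  exact congrArg Subtype.val
    ((LinearEquiv.ofInjective _ (stalkMap_idealSheafι_injective I.subschemeι x)).apply_symm_apply _)

lemma eq_stalkIdealEquiv {I : X.IdealSheafData} {x : X} {m : stalkAt (idealSheaf I.subschemeι) x}
    {r : I.stalkIdeal x}
    (h : stalkMap (idealSheafι I.subschemeι) x m = stalkToStructure x r.1) :
    m = stalkIdealEquiv I x r :=
  stalkMap_idealSheafι_injective _ _ (h.trans (stalkMap_stalkIdealEquiv I x r).symm)

lemma pushforwardStalk_toPushforwardStructure (f : X ⟶ Y) (x : X) (r : Y.presheaf.stalk (f x)) :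
    pushforwardStalk f _ x (stalkMap (toPushforwardStructure f) (f x) (stalkToStructure _ r)) =
      stalkToStructure x (f.stalkMap x r) := by
  obtain ⟨U, hU, r, rfl⟩ := Y.presheaf.exists_germ_eq r
  have h := congr(stalkToStructure x $(f.germ_stalkMap_apply U x hU r))
  refine Eq.trans ?_ h.symm
  refine Eq.trans ?_ (stalkToStructure_germ (mem_preimage hU) (f.app U r)).symm
  rw [stalkToStructure_germ, stalkMap_germ, toPushforwardStructure_app]
  exact pushforwardStalk_germ _ _ _ _

/-- The map from the ideal of a closed subscheme in a local ring to a stalk of the pullback of its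
ideal sheaf. -/
def pullbackIdeal (f : X ⟶ Y) (I : Y.IdealSheafData) (x : X) :
    I.stalkIdeal (f x) →ₛₗ[(f.stalkMap x).hom]
      stalkAt ((Scheme.Modules.pullback f).obj (idealSheaf I.subschemeι)) x :=
  (pullbackStalk f _ x).comp (stalkIdealEquiv I (f x)).toLinearMap

section

variable (f : X ⟶ Y) {I J : Y.IdealSheafData} {x : X}

lemma pullbackIdeal_surjective (h : Function.Surjective (f.stalkMap x).hom) :
    Function.Surjective (pullbackIdeal f I x) :=
  (pullbackStalk_surjective f _ h).comp (stalkIdealEquiv I (f x)).surjective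

lemma pullbackIdeal_eq_zero_iff (h : Function.Surjective (f.stalkMap x).hom)
    {r : I.stalkIdeal (f x)} :
    pullbackIdeal f I x r = 0 ↔ r.1 ∈ RingHom.ker (f.stalkMap x).hom * I.stalkIdeal (f x) := by
  refine (pullbackStalk_eq_zero_iff f _ h).trans ?_
  set 𝔞 := RingHom.ker (f.stalkMap x).hom
  have h1 : 𝔞 • (⊤ : Submodule (Y.presheaf.stalk (f x)) (stalkAt (idealSheaf I.subschemeι) (f x))) =
      (𝔞 • (⊤ : Submodule (Y.presheaf.stalk (f x)) (I.stalkIdeal (f x)))).map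
        (stalkIdealEquiv I (f x)).toLinearMap := by
    rw [Submodule.map_smul'', Submodule.map_top, LinearEquiv.range]
  have h2 : 𝔞 * I.stalkIdeal (f x) =
      (𝔞 • (⊤ : Submodule (Y.presheaf.stalk (f x)) (I.stalkIdeal (f x)))).map
        (I.stalkIdeal (f x)).subtype := by
    rw [Submodule.map_smul'', Submodule.map_top, Submodule.range_subtype]
    rfl
  rw [h1, h2]
  exact (Function.Injective.mem_set_image (stalkIdealEquiv I (f x)).injective).trans
    (Function.Injective.mem_set_image Subtype.val_injective).symm

lemma stalkMap_pullback_map_pullbackIdeal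
    {c : idealSheaf I.subschemeι ⟶ idealSheaf J.subschemeι}
    (hc : c ≫ idealSheafι J.subschemeι = idealSheafι I.subschemeι) (r : I.stalkIdeal (f x))
    (hr : r.1 ∈ J.stalkIdeal (f x)) :
    stalkMap ((Scheme.Modules.pullback f).map c) x (pullbackIdeal f I x r) =
      pullbackIdeal f J x ⟨r.1, hr⟩ := by
  refine (stalkMap_pullback_map f c _).trans congr(pullbackStalk f _ x $(eq_stalkIdealEquiv ?_))
  rw [← stalkMap_comp, hc]
  exact stalkMap_stalkIdealEquiv I _ r

/-- The morphism to the structure module from the pullback of an ideal sheaf. -/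
def pullbackIdealSheafι (f : X ⟶ Y) (I : Y.IdealSheafData) :
    (Scheme.Modules.pullback f).obj (idealSheaf I.subschemeι) ⟶ structureModule X :=
  ((Scheme.Modules.pullbackPushforwardAdjunction f).homEquiv _ _).symm
    (idealSheafι I.subschemeι ≫ toPushforwardStructure f)

lemma stalkMap_pullbackIdealSheafι (r : I.stalkIdeal (f x)) :
    stalkMap (pullbackIdealSheafι f I) x (pullbackIdeal f I x r) =
      stalkToStructure x (f.stalkMap x r.1) := by
  refine (stalkMap_homEquiv_symm f _ _).trans ?_
  rw [stalkMap_comp, ← pushforwardStalk_toPushforwardStructure]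
  exact congr(pushforwardStalk f _ x (stalkMap (toPushforwardStructure f) (f x)
    $(stalkMap_stalkIdealEquiv I _ r)))

/-- A section of an ideal sheaf on a neighbourhood of the image of `f` defines a morphism from the
structure module to the pullback of the ideal sheaf. -/
lemma exists_structureModule_to_pullback (f : X ⟶ Y) (I : Y.IdealSheafData) {U : Y.Opens}
    (hU : ∀ x, f x ∈ U) {s : Γ(Y, U)} (hs : I.subschemeι.app U s = 0) :
    ∃ σ : structureModule X ⟶ (Scheme.Modules.pullback f).obj (idealSheaf I.subschemeι),
      ∀ (x : X) (r : Y.presheaf.stalk (f x))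
        (h : r * Y.presheaf.germ U (f x) (hU x) s ∈ I.stalkIdeal (f x)),
        stalkMap σ x (stalkToStructure x (f.stalkMap x r)) = pullbackIdeal f I x ⟨_, h⟩ := by
  obtain ⟨m, hm⟩ := exists_idealSheafι_app_eq I.subschemeι hs
  have hU' : ⊤ ≤ f ⁻¹ᵁ U := fun x _ ↦ hU x
  refine ⟨homOfSection (res _ hU' (pullbackSection f _ U m)), fun x r h ↦ ?_⟩
  rw [stalkMap_homOfSection]
  have h1 : pullbackStalk f _ x (germ (idealSheaf I.subschemeι) (hU x) m) =
      germ _ (mem_preimage (hU x)) (pullbackSection f _ U m) := pullbackStalk_germ f _ (hU x) m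
  refine (congrArg (f.stalkMap x r • ·) ((germ_res hU' _ _).trans h1.symm)).trans ?_
  refine ((pullbackStalk f (idealSheaf I.subschemeι) x).map_smulₛₗ r _).symm.trans ?_
  refine congr(pullbackStalk f _ x $(eq_stalkIdealEquiv ?_))
  rw [map_smul, stalkMap_germ, hm, ← stalkToStructure_germ, ← map_smul]
  rfl

end

end OppositeSES
end

/-! ### Construction of the short exact sequence. -/

noncomputable section

namespace OppositeSES

lemma comap_fiberι_le {W S : Scheme.{u}} {p : W ⟶ S} {Y V : W.IdealSheafData}
    {E : S.IdealSheafData} (hYV : V ≤ Y ⊔ E.comap p) {ξ : S} (hξ : ξ ∈ E.support) :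
    V.comap (p.fiberι ξ) ≤ Y.comap (p.fiberι ξ) := by
  refine (Scheme.IdealSheafData.comap_mono (p.fiberι ξ) hYV).trans ?_
  dsimp only
  rw [Scheme.IdealSheafData.comap_sup, Scheme.IdealSheafData.comap_comap_fiberι p hξ, sup_bot_eq]

/-- For a preimmersion `f : X ⟶ W` and closed subschemes `Y` and `V` of `W` such that `τ` is the
equation of a divisor containing `f`, the pullback of the ideal sheaf of `Y ∪ V` is an extension of
the ideal sheaf of the pullback of `V` by the relative ideal sheaf of the pullbacks. -/
theorem exists_shortExact_pullback {X W : Scheme.{u}} (f : X ⟶ W) [IsPreimmersion f]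
    {Y V : W.IdealSheafData} (h : V.comap f ≤ Y.comap f) {U : W.Opens} (hU : ∀ x, f x ∈ U)
    (τ : Γ(W, U)) (hτ : V.subschemeι.app U τ = 0)
    (H : ∀ x, IsFiberPair (RingHom.ker (f.stalkMap x).hom) (Y.stalkIdeal (f x))
      (V.stalkIdeal (f x)) (W.presheaf.germ U (f x) (hU x) τ)) :
    ∃ (a : relativeIdealSheaf h ⟶
        (Scheme.Modules.pullback f).obj (idealSheaf (Y ⊓ V).subschemeι))
      (b : (Scheme.Modules.pullback f).obj (idealSheaf (Y ⊓ V).subschemeι) ⟶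
        idealSheaf (V.comap f).subschemeι)
      (w : a ≫ b = 0), (ShortComplex.mk a b w).ShortExact := by
  have hf (x) : Function.Surjective (f.stalkMap x).hom := f.stalkMap_surjective x
  have hI {x} (z) : z ∈ (Y ⊓ V).stalkIdeal (f x) ↔
      z ∈ Y.stalkIdeal (f x) ∧ z ∈ V.stalkIdeal (f x) := by
    rw [Scheme.IdealSheafData.stalkIdeal_inf]
    rfl
  have hcomap (I : W.IdealSheafData) {x} {r} (hr : r ∈ (I.comap f).stalkIdeal x) :
      ∃ i ∈ I.stalkIdeal (f x), f.stalkMap x i = r := by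
    rw [Scheme.IdealSheafData.stalkIdeal_comap] at hr
    exact (Ideal.mem_map_iff_of_surjective _ (hf x)).mp hr
  have hcomap' (I : W.IdealSheafData) {x} {i} (hi : i ∈ I.stalkIdeal (f x)) :
      f.stalkMap x i ∈ (I.comap f).stalkIdeal x := by
    rw [Scheme.IdealSheafData.stalkIdeal_comap]
    exact Ideal.mem_map_of_mem _ hi
  obtain ⟨c, hc⟩ := exists_lift_of_stalkMap (idealSheafι V.subschemeι)
    (idealSheafι (Y ⊓ V).subschemeι) (by
      intro x m
      obtain ⟨r, hr, hm⟩ := exists_stalkMap_idealSheafι (Y ⊓ V) m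
      rw [hm]
      exact exists_stalkMap_idealSheafι_eq
        (Scheme.IdealSheafData.stalkIdeal_mono inf_le_right x hr))
  -- `σ` is multiplication by `τ` from `𝒪_X` to the pullback of the ideal of `V`.
  obtain ⟨σ, hσ⟩ := exists_structureModule_to_pullback f V hU hτ
  have hτV {x} (r) : r * W.presheaf.germ U (f x) (hU x) τ ∈ V.stalkIdeal (f x) :=
    Ideal.mul_mem_left _ _ (H x).mem_right
  let c' := (Scheme.Modules.pullback f).map c
  have hc' {x} (z : (Y ⊓ V).stalkIdeal (f x)) : stalkMap c' x (pullbackIdeal f (Y ⊓ V) x z) =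
      pullbackIdeal f V x ⟨z.1, ((hI _).mp z.2).2⟩ :=
    stalkMap_pullback_map_pullbackIdeal f hc z _
  have : Mono c' := by
    -- Since `c'` is injective, all later identities can be checked in the pullback of the ideal of
    -- `V`.
    refine mono_of_stalkMap fun x n hn ↦ ?_
    obtain ⟨z, rfl⟩ := pullbackIdeal_surjective f (hf x) n
    rw [hc', pullbackIdeal_eq_zero_iff f (hf x)] at hn
    have h1 := (H x).mem_mul_inf _ ((hI _).mp z.2).1 hn
    rw [← Scheme.IdealSheafData.stalkIdeal_inf] at h1
    exact (pullbackIdeal_eq_zero_iff f (hf x)).mpr h1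
  -- For `i` in the ideal of `Y`, the product `i τ` lies in both ideals, so `σ` restricted to the
  -- ideal of the pullback of `Y` lands in the pullback of the ideal of `Y ∪ V`.
  obtain ⟨g, hg⟩ := exists_lift_of_stalkMap c' (idealSheafι (Y.comap f).subschemeι ≫ σ) (by
    intro x m
    obtain ⟨_, hr, hm⟩ := exists_stalkMap_idealSheafι _ m
    obtain ⟨i, hi, rfl⟩ := hcomap Y hr
    refine ⟨pullbackIdeal f (Y ⊓ V) x ⟨i * W.presheaf.germ U (f x) (hU x) τ,
      (hI _).mpr ⟨Ideal.mul_mem_right _ _ hi, hτV i⟩⟩, ?_⟩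
    rw [hc', stalkMap_comp, hm, hσ x i (hτV i)])
  have hg' {x} {m} {r} (hm : stalkMap (idealSheafι (Y.comap f).subschemeι) x m =
      stalkToStructure x (f.stalkMap x r)) :
      stalkMap c' x (stalkMap g x m) = pullbackIdeal f V x ⟨_, hτV r⟩ := by
    rw [← stalkMap_comp, hg, stalkMap_comp, hm, hσ x r (hτV r)]
  obtain ⟨e, he, he'⟩ := exists_idealSheaf_to_relativeIdealSheaf h
  have : Epi e := epi_of_stalkMap he
  -- For `j` in the ideal of `V`, `j τ ∈ 𝔞J` because `τ ∈ 𝔞`; so `g` descends to the relative ideal.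
  obtain ⟨a, ha⟩ := exists_desc_of_stalkMap e g (by
    intro x m hm
    obtain ⟨r, hr, hmr⟩ := exists_stalkMap_idealSheafι _ m
    obtain ⟨j, hj, rfl⟩ := hcomap V ((he' x m r hmr).mp hm)
    apply stalkMap_eq_zero_of_mono c'
    rw [hg' hmr, pullbackIdeal_eq_zero_iff f (hf x)]
    have h1 := Ideal.mul_mem_mul (H x).mem_fiber hj
    rwa [mul_comm _ j] at h1)
  have ha' {x} (m) : stalkMap a x (stalkMap e x m) = stalkMap g x m := by
    rw [← stalkMap_comp, ha]
  let q := pullbackIdealSheafι f V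
  have hq {x} (z : (Y ⊓ V).stalkIdeal (f x)) :
      stalkMap (c' ≫ q) x (pullbackIdeal f (Y ⊓ V) x z) = stalkToStructure x (f.stalkMap x z.1) := by
    rw [stalkMap_comp, hc', stalkMap_pullbackIdealSheafι]
  obtain ⟨b, hb⟩ := exists_lift_of_stalkMap (idealSheafι (V.comap f).subschemeι) (c' ≫ q) (by
    intro x n
    obtain ⟨z, rfl⟩ := pullbackIdeal_surjective f (hf x) n
    rw [hq]
    exact exists_stalkMap_idealSheafι_eq (hcomap' V ((hI _).mp z.2).2))
  have hb' {x} (n) : stalkMap (idealSheafι (V.comap f).subschemeι) x (stalkMap b x n) =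
      stalkMap (c' ≫ q) x n := by
    rw [← stalkMap_comp, hb]
  refine ⟨a, b, ?_, shortExact_of_stalkMap _ _ _ ?_ ?_ ?_⟩
  · refine eq_zero_of_stalkMap fun x k ↦ ?_
    obtain ⟨m, rfl⟩ := he x k
    obtain ⟨_, hr, hm⟩ := exists_stalkMap_idealSheafι _ m
    obtain ⟨i, hi, rfl⟩ := hcomap Y hr
    apply stalkMap_eq_zero_of_mono (idealSheafι (V.comap f).subschemeι)
    rw [stalkMap_comp, ha', hb', stalkMap_comp, hg' hm, stalkMap_pullbackIdealSheafι]
    have : f.stalkMap x (i * W.presheaf.germ U (f x) (hU x) τ) = 0 :=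
      Ideal.mul_mem_left _ i (H x).mem_fiber
    rw [this, map_zero]
  · intro x k hk
    obtain ⟨m, rfl⟩ := he x k
    obtain ⟨_, hr, hm⟩ := exists_stalkMap_idealSheafι _ m
    obtain ⟨i, hi, rfl⟩ := hcomap Y hr
    rw [ha'] at hk
    have h1 := hg' hm
    rw [hk, map_zero, eq_comm, pullbackIdeal_eq_zero_iff f (hf x)] at h1
    rw [he' x m _ hm]
    -- If `i τ` dies, then `i ∈ J + 𝔞`, so `i` restricts to zero on the pullback of `V`.
    obtain ⟨j, hj, d, hd, rfl⟩ := Submodule.mem_sup.mp ((H x).mem_sup i h1)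
    rw [map_add, show f.stalkMap x d = 0 from hd, add_zero]
    exact hcomap' V hj
  · intro x n hn
    obtain ⟨z, rfl⟩ := pullbackIdeal_surjective f (hf x) n
    have h1 := hb' (pullbackIdeal f (Y ⊓ V) x z)
    rw [hn, map_zero, hq] at h1
    -- A class killed by `b` has its representative `z` in `𝔞`; then `z` agrees with `i τ` modulo
    -- `𝔞(I ⊓ J)`, and `i` supplies the preimage.
    obtain ⟨i, hi, hiz⟩ := (H x).exists_sub_mem z.1 ((hI _).mp z.2)
      (stalkToStructure_injective x h1.symm)
    obtain ⟨m, hm⟩ := exists_stalkMap_idealSheafι_eq (hcomap' Y hi)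
    refine ⟨stalkMap e x m, ?_⟩
    rw [ha', ← sub_eq_zero]
    apply stalkMap_eq_zero_of_mono c'
    rw [map_sub, hg' hm, hc', ← map_sub, pullbackIdeal_eq_zero_iff f (hf x), ← neg_mem_iff]
    have h2 := Ideal.mul_mono_right (I := RingHom.ker (f.stalkMap x).hom) inf_le_right hiz
    rwa [← neg_sub] at h2
  · intro x y
    obtain ⟨_, hr, hy⟩ := exists_stalkMap_idealSheafι _ y
    obtain ⟨j, hj, rfl⟩ := hcomap V hr
    -- The lift `j - r τ` is in both ideals and has the same restriction to the fibre as `j`,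
    -- because `τ ∈ 𝔞`.
    obtain ⟨r, hrj⟩ := (H x).exists_sub_mem_left j hj
    refine ⟨pullbackIdeal f (Y ⊓ V) x ⟨_, (hI _).mpr ⟨hrj, sub_mem hj (hτV r)⟩⟩, ?_⟩
    apply stalkMap_idealSheafι_injective
    rw [hb', hq, hy, map_sub, sub_eq_self.mpr]
    exact Ideal.mul_mem_left _ r (H x).mem_fiber

end OppositeSES

end

theorem lemma4p6 {k : Type u} [Field k] {X S : Scheme.{u}}
    (f : X ⟶ Spec (.of k)) (g : S ⟶ Spec (.of k))
    (hX : OppositeSES.IsProjective f)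
    -- closed subschemes `Y` and `V` of `X × S` and `E` of `S`, given by their ideal sheaves
    (Y V : (pullback f g).IdealSheafData) (E : S.IdealSheafData)
    (hY : AlgebraicGeometry.Flat (Y.subschemeι ≫ pullback.snd f g))
    (hE : OppositeSES.IsCartierDivisor E)
    -- `V ⊆ X × E`, and `V` is flat over `E`
    (hVE : E.comap (pullback.snd f g) ≤ V)
    (hV : AlgebraicGeometry.Flat (Scheme.IdealSheafData.subschemeMap V E (pullback.snd f g)
      (Scheme.IdealSheafData.le_map_iff_comap_le.mpr hVE)))
    -- `Y ∩ (X × E) ⊆ V`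
    (hYV : V ≤ Y ⊔ E.comap (pullback.snd f g)) :
    (∀ ξ ∈ E.support,
      ∃ h : V.comap ((pullback.snd f g).fiberι ξ) ≤ Y.comap ((pullback.snd f g).fiberι ξ),
      ∃ (a : OppositeSES.relativeIdealSheaf h ⟶
          (Scheme.Modules.pullback ((pullback.snd f g).fiberι ξ)).obj
            (OppositeSES.idealSheaf (Y ⊓ V).subschemeι))
        (b : (Scheme.Modules.pullback ((pullback.snd f g).fiberι ξ)).obj
            (OppositeSES.idealSheaf (Y ⊓ V).subschemeι) ⟶
          OppositeSES.idealSheaf (V.comap ((pullback.snd f g).fiberι ξ)).subschemeι)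
        (w : a ≫ b = 0),
        (ShortComplex.mk a b w).ShortExact) ∧
    ((∀ ξ ∈ E.support, ∃ U : S.Opens, ξ ∈ U ∧ AlgebraicGeometry.IsIntegral (U : Scheme.{u})) →
      OppositeSES.IsFlatOver (pullback.snd f g)
        (OppositeSES.idealSheaf (Y ⊓ V).subschemeι)) := by
  refine ⟨fun ξ hξ ↦ ⟨OppositeSES.comap_fiberι_le hYV hξ, ?_⟩,
    fun _ ↦ OppositeSES.isFlatOver_idealSheaf _ Y V E hE hY hVE hV hYV⟩
  obtain ⟨U, hU, t, ht, hEU⟩ := hE ξ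
  have hx (x) : (pullback.snd f g).fiberι ξ x ∈ pullback.snd f g ⁻¹ᵁ U.1 := by
    change pullback.snd f g ((pullback.snd f g).fiberι ξ x) ∈ U.1
    rwa [Scheme.Hom.apply_fiberι]
  refine OppositeSES.exists_shortExact_pullback _ (OppositeSES.comap_fiberι_le hYV hξ) hx
    ((pullback.snd f g).app U.1 t) ?_ fun x ↦
      Scheme.isFiberPair_stalkIdeal _ Y V E hY hVE hV hYV ht hEU hξ x (hx x)
  have h1 : E ≤ (V.subschemeι ≫ pullback.snd f g).ker := by
    have h2 := Scheme.IdealSheafData.le_map_iff_comap_le.mpr hVE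
    rwa [← V.ker_subschemeι, Scheme.IdealSheafData.map_ker] at h2
  have h2 := Scheme.Hom.ideal_ker_le _ _ (h1 U (hEU ▸ Ideal.mem_span_singleton_self t))
  rw [RingHom.mem_ker] at h2
  exact h2
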